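/- **Setting.** Let $\mathfrak g$ be a finite-dimensional complex simple Lie algebra, $\mathfrak h$ a Cartan subalgebra, $\Delta$ the set of roots with root spaces $\mathfrak g_\varphi$ ($\varphi\in\Delta$), $\Pi$ a base of simple roots, and $\Delta_+$ the corresponding positive roots. For $\varphi\in\Delta$ write $\varphi=\sum_{\alpha\in\Pi}n_\alpha(\varphi)\,\alpha$, and let $\psi\in\Delta$ be the highest root. Let $\mathfrak b=\mathfrak h+\sum_{\varphi\in\Delta_+}\mathfrak g_\varphi$ and let $\mathfrak q\supseteq\mathfrak b$ be a Lie subalgebra with $\mathfrak q\ne\mathfrak g$ (a standard proper parabolic subalgebra). Let $\mathfrak n$ be the nilradical of $\mathfrak q$ (its largest nilpotent ideal), and let $\mathfrak m\supseteq\mathfrak h$ be the Levi factor of $\mathfrak q$ containing $\mathfrak h$, so that $\mathfrak q=\mathfrak m\oplus\mathfrak n$ as vector spaces. Let $\mathfrak t$ be the center of $\mathfrak m$ (so $\mathfrak t\subseteq\mathfrak h$) and $\mathfrak s=[\mathfrak m,\mathfrak m]$. For $\nu\in\mathfrak t^*$ let $\mathfrak g_\nu=\{z\in\mathfrak g : [x,z]=\nu(x)z\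 \text{for all } x\in\mathfrak t\}$; $\nu$ is a *$\mathfrak t$-root* if $\nu\neq0$ and $\mathfrak g_\nu\ne0$. A $\mathfrak t$-root $\nu$ is *positive* if $\mathfrak g_\nu\subseteq\mathfrak n$, and *simple* if it is positive and is not the sum of two positive $\mathfrak t$-roots. For $\varphi\in\mathfrak h^*$ let $\varphi_{\mathfrak t}=\varphi|_{\mathfrak t}$. Let $\alpha_1,\dots,\alpha_\ell$ be the simple roots $\alpha\in\Pi$ with $\mathfrak g_\alpha\not\subseteq\mathfrak s$, and put $\beta_j=(\alpha_j)_{\mathfrak t}$. For a $\mathfrak t$-root $\nu$ put $o(\nu)=\sum_{j=1}^{\ell}n_{\alpha_j}(\varphi)$, where $\varphi\in\Delta$ is any root with $\mathfrak g_\varphi\subseteq\mathfrak g_\nu$ (the value does not depend on the choice of $\varphi$). For an integer $k$ let $\mathfrak n(k)=\sum_{\nu}\mathfrak g_\nu$, the sum over the $\mathfrak t$-roots $\nu$ with $o(\nu)=k$. Put $\nu(\mathrm{cent})=\psi_{\mathfrak t}$ and $k(\mathrm{cent})=o(\nu(\mathrm{cent}))$. The upper central series of $\mathfrak n$ is defined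 by $\mathfrak n_0=0$ and $\mathfrak n_i/\mathfrak n_{i-1}=\operatorname{cent}(\mathfrak n/\mathfrak n_{i-1})$ for $i\ge1$, so $\mathfrak n_1=\operatorname{cent}\mathfrak n$. Its length is the number $d$ such that $\mathfrak n_0\subsetneq\mathfrak n_1\subsetneq\cdots\subsetneq\mathfrak n_d=\mathfrak n$. The bracket $[U,V]$ of two subspaces denotes the linear span of all $[u,v]$ with $u\in U$, $v\in V$. **Theorem 2.11.** 1. Let $i\ge 0$ be an integer with $i<k(\mathrm{cent})$ and let $\nu$ be a $\mathfrak t$-root with $\mathfrak g_\nu\subseteq\mathfrak n(i)$. Then there is $j\in\{1,\dots,\ell\}$ such that $\beta_j$ is a simple $\mathfrak t$-root, $\nu+\beta_j$ is a $\mathfrak t$-root, $\mathfrak g_{\nu+\beta_j}\subseteq\mathfrak n(i+1)$, and $$[\mathfrak g_\nu,\mathfrak g_{\beta_j}]=\mathfrak g_{\nu+\beta_j}.$$ In particular $[\mathfrak g_\nu,\mathfrak g_{\beta_j}]\neq0$. 2. $\mathfrak g_{\nu(\mathrm{cent})}=\operatorname{cent}\mathfrak n$. 3. For $1\le i\le k(\mathrm{cent})$,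 $$\mathfrak n_i=\sum_{j=1}^{i}\mathfrak n(k(\mathrm{cent})-j+1).$$ 4. The length of the upper central series of $\mathfrak n$ is $k(\mathrm{cent})$. -/

import Mathlib

open LieAlgebra LieModule

noncomputable section

namespace LeviRoots

/-! ### Nilradical, Levi factor, and ideals viewed inside the big algebra -/

section General

variable {L : Type*} [LieRing L] [LieAlgebra ℂ L]

/-- The nilradical of a Lie subalgebra `q`: the sum of all ideals of `q` which are nilpotent as Lie
algebras, regarded as a Lie subalgebra of the ambient Lie algebra. (This is not
`LieAlgebra.maxNilpotentIdeal`, which asks an ideal to be nilpotent as a module over `q`.) -/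
def nilradical (q : LieSubalgebra ℂ L) : LieSubalgebra ℂ L :=
  (LieIdeal.toLieSubalgebra ℂ q (sSup {I : LieIdeal ℂ q | LieRing.IsNilpotent I})).map q.incl

/-- `m` is a Levi factor of the parabolic subalgebra `q`: a Lie subalgebra which is a vector space
complement in `q` of the nilradical of `q`, that is, `q = m + n` is a Levi decomposition. -/
structure IsLeviFactor (q m : LieSubalgebra ℂ L) : Prop where
  sup_eq : m.toSubmodule ⊔ (nilradical q).toSubmodule = q.toSubmodule
  disjoint : Disjoint m.toSubmodule (nilradical q).toSubmodule

/-- An ideal of a Lie subalgebra, as a subspace of the ambient Lie algebra. -/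
def ambient (k : LieSubalgebra ℂ L) (I : LieIdeal ℂ k) : Submodule ℂ L :=
  I.toSubmodule.map k.toSubmodule.subtype

/-- `[U, V]`: the linear span of the brackets `[u, v]` with `u ∈ U` and `v ∈ V`. -/
def bracket (U V : Submodule ℂ L) : Submodule ℂ L :=
  Submodule.span ℂ {z | ∃ u ∈ U, ∃ v ∈ V, ⁅u, v⁆ = z}

/-- The `i`-th term of the upper central series of a Lie subalgebra `n`, as a subspace of the
ambient Lie algebra; the `0`-th term is zero and the first term is the center. -/
def upperCentral (n : LieSubalgebra ℂ L) (i : ℕ) : Submodule ℂ L :=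
  ambient n ((⊥ : LieIdeal ℂ n).ucs i)

/-- The upper central series of `n` has length `d`: its terms are distinct up to index `d`, where
it reaches `n`. -/
def HasUpperCentralLength (n : LieSubalgebra ℂ L) (d : ℕ) : Prop :=
  upperCentral n d = n.toSubmodule ∧ StrictMonoOn (upperCentral n) (Set.Iic d)

/-- `𝔱`, the center of `m`. -/
abbrev Cent (m : LieSubalgebra ℂ L) : LieIdeal ℂ m := LieAlgebra.center ℂ m

/-- The weight space `𝔤_ν` of the center `𝔱` of `m`, for `ν ∈ 𝔱*`, in the adjoint representation. -/
def tRootSpace (m : LieSubalgebra ℂ L) (ν : Module.Dual ℂ (Cent m)) : Submodule ℂ L where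
  carrier := {z | ∀ x : Cent m, ⁅((x : m) : L), z⁆ = ν x • z}
  add_mem' := by
    intro a b ha hb x
    rw [lie_add, ha x, hb x, smul_add]
  zero_mem' := by
    intro x
    simp
  smul_mem' := by
    intro c a ha x
    rw [lie_smul, ha x, smul_comm]

/-- `ν` is a `𝔱`-root. -/
def IsTRoot (m : LieSubalgebra ℂ L) (ν : Module.Dual ℂ (Cent m)) : Prop :=
  ν ≠ 0 ∧ tRootSpace m ν ≠ ⊥

/-- `ν` is a positive `𝔱`-root: one whose root space lies in the nilradical of `q`. -/
def IsPosTRoot (q m : LieSubalgebra ℂ L) (ν : Module.Dual ℂ (Cent m)) : Prop :=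
  IsTRoot m ν ∧ tRootSpace m ν ≤ (nilradical q).toSubmodule

/-- `ν` is a simple `𝔱`-root: positive, and not the sum of two positive `𝔱`-roots. -/
def IsSimpleTRoot (q m : LieSubalgebra ℂ L) (ν : Module.Dual ℂ (Cent m)) : Prop :=
  IsPosTRoot q m ν ∧
    ∀ ν₁ ν₂ : Module.Dual ℂ (Cent m), IsPosTRoot q m ν₁ → IsPosTRoot q m ν₂ → ν ≠ ν₁ + ν₂

lemma coe_cent_mem {H : LieSubalgebra ℂ L} [H.IsCartanSubalgebra] {m : LieSubalgebra ℂ L} (hm : H ≤ m) (x : Cent m) :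
    ((x : m) : L) ∈ H := by
  rw [← LieSubalgebra.IsCartanSubalgebra.self_normalizing (H := H),
    LieSubalgebra.mem_normalizer_iff]
  intro y hy
  have h : ⁅(⟨y, hm hy⟩ : m), (x : m)⁆ = 0 := x.2 ⟨y, hm hy⟩
  have h' : ⁅y, ((x : m) : L)⁆ = 0 := congrArg (fun z : m => (z : L)) h
  rw [← lie_skew, h', neg_zero]
  exact H.zero_mem

end General

/-! ### Roots of a Cartan subalgebra and their restrictions to `𝔱` -/

section Cartan

variable {L : Type*} [LieRing L] [LieAlgebra ℂ L] [FiniteDimensional ℂ L] [IsKilling ℂ L]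
variable {H : LieSubalgebra ℂ L} [H.IsCartanSubalgebra]

/-- The Borel subalgebra attached to a base, as a subspace: the Cartan subalgebra plus all positive
root spaces. -/
def borel (b : (IsKilling.rootSystem H).Base) : Submodule ℂ L :=
  H.toSubmodule ⊔ ⨆ (φ : H.root) (_ : b.IsPos φ), (rootSpace H (φ : Weight ℂ H L)).toSubmodule

/-- `n_α(φ)`: the coefficient of the simple root `α` in the root `φ`. -/
def simpleCoeff (b : (IsKilling.rootSystem H).Base) (φ : H.root) (α : b.support) : ℤ :=
  b.toWeightBasisInt.repr ((IsKilling.rootSystem H).rootSpanMem ℤ φ) α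

/-- `ψ` is the highest root: it is maximal for the partial order on roots in which `ψ ≤ φ` means
that `φ - ψ` is a sum of simple roots. -/
def IsHighestRoot (b : (IsKilling.rootSystem H).Base) (ψ : H.root) : Prop :=
  ∀ φ : H.root,
    (IsKilling.rootSystem H).root φ - (IsKilling.rootSystem H).root ψ ∈
      AddSubmonoid.closure ((IsKilling.rootSystem H).root '' b.support) → φ = ψ

/-- The simple root `α` is a root of `𝔰 = [m, m]`. -/
def IsLeviSimple (b : (IsKilling.rootSystem H).Base) (m : LieSubalgebra ℂ L) (α : b.support) :
    Prop :=
  (rootSpace H ((α : H.root) : Weight ℂ H L)).toSubmodule ≤ ambient m (derivedSeries ℂ m 1)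

/-- The coefficient of `ν` at the simple root `α`: it is `n_α(φ)` for any root `φ` whose root space
lies in `𝔤_ν` (and `0` if there is none). It is used for `α` outside `𝔰` and `𝔱`-roots `ν`, in which
case it does not depend on the choice of `φ`. -/
def tCoeff (b : (IsKilling.rootSystem H).Base) (m : LieSubalgebra ℂ L)
    (ν : Module.Dual ℂ (Cent m)) (α : b.support) : ℤ :=
  open Classical in
  if h : ∃ φ : H.root, (rootSpace H (φ : Weight ℂ H L)).toSubmodule ≤ tRootSpace m ν then
    simpleCoeff b h.choose α
  else 0

/-- The order `o(ν)`: the sum of the coefficients of `ν` at the simple roots outside `𝔰`. -/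
def order (b : (IsKilling.rootSystem H).Base) (m : LieSubalgebra ℂ L)
    (ν : Module.Dual ℂ (Cent m)) : ℤ :=
  open Classical in
  ∑ α : b.support with ¬ IsLeviSimple b m α, tCoeff b m ν α

/-- `n(k)`: the sum of the root spaces of the `𝔱`-roots of order `k`. -/
def layer (b : (IsKilling.rootSystem H).Base) (m : LieSubalgebra ℂ L) (k : ℤ) : Submodule ℂ L :=
  ⨆ (ν : Module.Dual ℂ (Cent m)) (_ : IsTRoot m ν ∧ order b m ν = k), tRootSpace m ν

/-- The inclusion of `𝔱` in a Cartan subalgebra contained in `m`. -/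
def centIncl {m : LieSubalgebra ℂ L} (hm : H ≤ m) : Cent m →ₗ[ℂ] H where
  toFun x := ⟨((x : m) : L), coe_cent_mem hm x⟩
  map_add' _ _ := rfl
  map_smul' _ _ := rfl

/-- `φ_𝔱`: the restriction of the root `φ` to `𝔱`. -/
def resT {m : LieSubalgebra ℂ L} (hm : H ≤ m) (φ : H.root) : Module.Dual ℂ (Cent m) :=
  (IsKilling.rootSystem H).root φ ∘ₗ centIncl hm

end Cartan

end LeviRoots

end

/-! Everything is reduced to roots. Let `S` be the set of simple roots whose negatives are roots of
`q`, and let the outer height of a root be the sum of its coefficients outside `S`. It is additive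
and grades the root spaces: `q`, `n` and `m` have the roots of outer height `≥ 0`, `> 0` and `= 0`,
with `H` added to `q` and `m`. The fundamental coweights of the simple roots outside `S` lie in `𝔱`,
and the roots in `S` vanish on `𝔱`. Hence two roots agree on `𝔱` exactly when their coefficients
outside `S` agree (`SameOuter`), a `𝔱`-root space is the sum of the root spaces in one such fiber,
and `o(ν)` is the outer height.

Three facts carry the theorem. Raising (`IsHighestRoot.exists_add_mem`): a root of outer height
strictly between zero and that of `ψ` stays a root after adding some root of outer height `1`. This
rests on the uniqueness of the highest root and on the Jacobi identity. Irreducibility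
(`mem_of_sameOuter`): a nonempty part of a fiber of nonzero outer height, closed under adding roots
of outer height zero, is the whole fiber. Consequently (`IsLeviFactor.bracket_eq`) the bracket of
two `𝔱`-root spaces fills the root space of the sum once a single pair of roots adds up to a root.

Statement 1 is raising together with the bracket formula. For the central series, bracketing with
`n` strictly increases outer height, so the top `i` layers lie in `n_i`; raising shows that no lower
root space does. -/

set_option linter.unusedSectionVars false

noncomputable section

namespace LeviRoots

/-! ### Root spaces, their brackets, and subspaces stable under the Cartan subalgebra -/

section RootSpaces

variable {L : Type*} [LieRing L] [LieAlgebra ℂ L] [FiniteDimensional ℂ L] [IsKilling ℂ L]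
variable {H : LieSubalgebra ℂ L} [H.IsCartanSubalgebra]

open IsKilling

/-- The root space of a root, as a subspace. -/
abbrev rootSub (φ : H.root) : Submodule ℂ L :=
  (rootSpace H (φ : Weight ℂ H L)).toSubmodule

/-- The sum of the root spaces of a set of roots. -/
def rootSum (Φ : Set H.root) : Submodule ℂ L := ⨆ φ ∈ Φ, rootSub φ

lemma mem_rootSub_iff {φ : H.root} {x : L} :
    x ∈ rootSub φ ↔ ∀ h : H, ⁅(h : L), x⁆ = (rootSystem H).root φ h • x := by
  constructor
  · intro hx h
    exact lie_eq_smul_of_mem_rootSpace hx h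
  · intro hx
    exact weightSpace_le_genWeightSpace L _ ((mem_weightSpace _ x).2 hx)

lemma exists_ne_zero_mem_rootSub (φ : H.root) : ∃ e ∈ rootSub φ, e ≠ 0 :=
  (φ : Weight ℂ H L).exists_ne_zero

lemma rootSub_ne_bot (φ : H.root) : rootSub φ ≠ ⊥ := by
  obtain ⟨e, he, he0⟩ := exists_ne_zero_mem_rootSub φ
  exact fun h ↦ he0 (by simpa [h] using he)

lemma rootSub_eq_span {φ : H.root} {e : L} (he : e ∈ rootSub φ) (he0 : e ≠ 0) :
    rootSub φ = Submodule.span ℂ {e} := by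
  refine le_antisymm (fun y hy ↦ ?_) (by simpa using he)
  have h1 := (finrank_eq_one_iff_of_nonzero' (⟨e, he⟩ : rootSpace H (φ : Weight ℂ H L))
    (by simpa using he0)).1 (finrank_rootSpace_eq_one _ (H.isNonZero_coe_root φ))
  obtain ⟨c, hc⟩ := h1 ⟨y, hy⟩
  exact Submodule.mem_span_singleton.2 ⟨c, congrArg Subtype.val hc⟩

lemma rootSub_le_of_mem {φ : H.root} {e : L} (he : e ∈ rootSub φ) (he0 : e ≠ 0)
    {W : Submodule ℂ L} (h : e ∈ W) : rootSub φ ≤ W := by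
  rw [rootSub_eq_span he he0]
  simpa using h

lemma lie_mem_rootSub {φ γ η : H.root}
    (h : (rootSystem H).root η = (rootSystem H).root φ + (rootSystem H).root γ)
    {x y : L} (hx : x ∈ rootSub φ) (hy : y ∈ rootSub γ) : ⁅x, y⁆ ∈ rootSub η := by
  have := lie_mem_genWeightSpace_of_mem_genWeightSpace hx hy
  have h0 : ((φ : Weight ℂ H L) : H → ℂ) + ((γ : Weight ℂ H L) : H → ℂ) =
      ((η : Weight ℂ H L) : H → ℂ) := by
    ext t
    exact (LinearMap.congr_fun h t).symm
  rwa [h0] at this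

lemma lie_mem_cartan {φ γ : H.root}
    (h : (rootSystem H).root φ + (rootSystem H).root γ = 0)
    {x y : L} (hx : x ∈ rootSub φ) (hy : y ∈ rootSub γ) : ⁅x, y⁆ ∈ H := by
  have h0 : ((φ : Weight ℂ H L) : H → ℂ) + ((γ : Weight ℂ H L) : H → ℂ) = 0 := by
    ext t
    exact LinearMap.congr_fun h t
  have h1 : ⁅x, y⁆ ∈ rootSpace H (0 : H → ℂ) := by
    rw [← h0]
    exact lie_mem_genWeightSpace_of_mem_genWeightSpace hx hy
  rw [rootSpace_zero_eq] at h1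
  simpa using h1

lemma lie_eq_zero_of_add_notMem {φ γ : H.root}
    (h0 : (rootSystem H).root φ + (rootSystem H).root γ ≠ 0)
    (h : (rootSystem H).root φ + (rootSystem H).root γ ∉ Set.range (rootSystem H).root)
    {x y : L} (hx : x ∈ rootSub φ) (hy : y ∈ rootSub γ) : ⁅x, y⁆ = 0 := by
  have := lie_mem_genWeightSpace_of_mem_genWeightSpace hx hy
  by_contra hne
  apply h
  have hb : genWeightSpace L (((φ : Weight ℂ H L) : H → ℂ) + ((γ : Weight ℂ H L) : H → ℂ)) ≠ ⊥ := by
    intro hb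
    rw [hb] at this
    exact hne (by simpa using this)
  refine ⟨⟨⟨_, hb⟩, ?_⟩, ?_⟩
  · simp only [LieSubalgebra.root, Finset.mem_filter, Finset.mem_univ, true_and]
    intro hz
    apply h0
    ext t
    exact congrFun hz t
  · ext t
    rfl

/-- Representation theory of the `sl₂` attached to `φ`. The top of the `φ`-string through `γ`
carries a primitive vector `z`, and some `f ^ (n + 1) z` is a nonzero element of the root space of
`γ`. Since `φ + γ` is a root, `γ` is not the top of the string, so `e` does not kill that vector;
both root spaces being lines, this settles every choice of `x` and `y`. -/
lemma lie_ne_zero_of_add_mem {φ γ η : H.root}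
    (h : (rootSystem H).root η = (rootSystem H).root φ + (rootSystem H).root γ)
    {x y : L} (hx : x ∈ rootSub φ) (hx0 : x ≠ 0) (hy : y ∈ rootSub γ) (hy0 : y ≠ 0) :
    ⁅x, y⁆ ≠ 0 := by
  let α : Weight ℂ H L := φ.1
  let β : Weight ℂ H L := γ.1
  have hα : α.IsNonZero := H.isNonZero_coe_root φ
  have htop : 1 ≤ chainTopCoeff α β := by
    have h1 : rootSpace H ((1 : ℤ) • α + β : H → ℂ) ≠ ⊥ := by
      have : ((1 : ℤ) • α + β : H → ℂ) = ((η : Weight ℂ H L) : H → ℂ) := by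
        ext t
        simpa using (LinearMap.congr_fun h t).symm
      rw [this]
      exact (η : Weight ℂ H L).genWeightSpace_ne_bot
    have := ((rootSpace_zsmul_add_ne_bot_iff α β hα 1).1 h1).1
    exact_mod_cast this
  obtain ⟨z, hz, hz0⟩ := (chainTop α β).exists_ne_zero
  obtain ⟨h', e, f, isSl2, he, hf⟩ := exists_isSl2Triple_of_weight_isNonZero hα
  obtain rfl := isSl2.h_eq_coroot hα he hf
  have prim : isSl2.HasPrimitiveVectorWith z (chainLength α β : ℂ) :=
    have := lie_mem_genWeightSpace_of_mem_genWeightSpace he hz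
    ⟨hz0, (chainLength_smul _ _ hz).symm, by rwa [genWeightSpace_add_chainTop _ _ hα] at this⟩
  obtain ⟨n, hn⟩ : ∃ n, chainTopCoeff α β = n + 1 := ⟨chainTopCoeff α β - 1, by lia⟩
  have hlen := chainTopCoeff_le_chainLength α β
  have hw0 := prim.pow_toEnd_f_ne_zero_of_eq_nat rfl (i := n + 1) (by lia)
  have hw0' := prim.pow_toEnd_f_ne_zero_of_eq_nat rfl (i := n) (by lia)
  have hw : ((toEnd ℂ L L f) ^ (n + 1)) z ∈ rootSub γ := by
    have := toEnd_pow_apply_mem hf hz (n + 1)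
    have e1 : (n + 1) • -(α : H → ℂ) + chainTop α β = (β : H → ℂ) := by
      rw [coe_chainTop', hn, smul_neg, neg_add_cancel_left]
    rw [e1] at this
    exact this
  have he' : ⁅e, ((toEnd ℂ L L f) ^ (n + 1)) z⁆ ≠ 0 := by
    -- The scalar is `(n + 1) * (chainLength - n)`, nonzero because `n + 1 = chainTopCoeff ≤
    -- chainLength`.
    rw [prim.lie_e_pow_succ_toEnd_f]
    refine smul_ne_zero (mul_ne_zero (Nat.cast_add_one_ne_zero n) ?_) hw0'
    rw [sub_ne_zero]
    norm_cast
    lia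
  have h1 : e ∈ Submodule.span ℂ {x} := by
    rw [← rootSub_eq_span hx hx0]; exact he
  have h2 : ((toEnd ℂ L L f) ^ (n + 1)) z ∈ Submodule.span ℂ {y} := by
    rwa [← rootSub_eq_span hy hy0]
  obtain ⟨c, rfl⟩ := Submodule.mem_span_singleton.1 h1
  obtain ⟨d, hd⟩ := Submodule.mem_span_singleton.1 h2
  rw [← hd] at he'
  intro h3
  simp [h3] at he'

lemma rootSub_le_of_lie {φ γ η : H.root}
    (h : (rootSystem H).root η = (rootSystem H).root φ + (rootSystem H).root γ)
    {W : Submodule ℂ L} (hW : ∀ x ∈ rootSub φ, ∀ y ∈ rootSub γ, ⁅x, y⁆ ∈ W) : rootSub η ≤ W := by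
  obtain ⟨x, hx, hx0⟩ := exists_ne_zero_mem_rootSub φ
  obtain ⟨y, hy, hy0⟩ := exists_ne_zero_mem_rootSub γ
  exact rootSub_le_of_mem (lie_mem_rootSub h hx hy) (lie_ne_zero_of_add_mem h hx hx0 hy hy0)
    (hW x hx y hy)

lemma exists_lie_ne_zero_mem_cartan {φ γ : H.root}
    (h : (rootSystem H).root γ = -(rootSystem H).root φ) :
    ∃ x ∈ rootSub φ, ∃ y ∈ rootSub γ, ⁅x, y⁆ ∈ H ∧ ⁅x, y⁆ ≠ 0 := by
  obtain ⟨h', e, f, t, he, hf⟩ := exists_isSl2Triple_of_weight_isNonZero (H.isNonZero_coe_root φ)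
  have hf' : f ∈ rootSub γ := by
    have : ((γ : Weight ℂ H L) : H → ℂ) = -((φ : Weight ℂ H L) : H → ℂ) := by
      ext s
      exact LinearMap.congr_fun h s
    rw [rootSub, this]
    exact hf
  refine ⟨e, he, f, hf', lie_mem_cartan (by rw [h, add_neg_cancel]) he hf', ?_⟩
  rw [t.lie_e_f]
  exact t.h_ne_zero

/-- If `α + γ` and `α + γ + δ` are roots, then one of `γ + δ`, `α + δ` is a root, provided
neither is zero. -/
lemma add_mem_range_or_add_mem_range {α γ δ σ τ : H.root}
    (h1 : (rootSystem H).root σ = (rootSystem H).root α + (rootSystem H).root γ)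
    (h2 : (rootSystem H).root τ = (rootSystem H).root σ + (rootSystem H).root δ)
    (h3 : (rootSystem H).root γ + (rootSystem H).root δ ≠ 0)
    (h4 : (rootSystem H).root α + (rootSystem H).root δ ≠ 0) :
    (rootSystem H).root γ + (rootSystem H).root δ ∈ Set.range (rootSystem H).root ∨
      (rootSystem H).root α + (rootSystem H).root δ ∈ Set.range (rootSystem H).root := by
  by_contra! hcon
  obtain ⟨x, hx, hx0⟩ := exists_ne_zero_mem_rootSub α
  obtain ⟨y, hy, hy0⟩ := exists_ne_zero_mem_rootSub γ
  obtain ⟨z, hz, hz0⟩ := exists_ne_zero_mem_rootSub δ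
  have := lie_ne_zero_of_add_mem h2 (lie_mem_rootSub h1 hx hy)
    (lie_ne_zero_of_add_mem h1 hx hx0 hy hy0) hz hz0
  apply this
  -- By Jacobi the nonzero bracket `⁅⁅x, y⁆, z⁆` is a difference of terms containing `⁅y, z⁆` and
  -- `⁅x, z⁆`, which would both vanish.
  rw [lie_lie, lie_eq_zero_of_add_notMem h3 hcon.1 hy hz,
    lie_eq_zero_of_add_notMem h4 hcon.2 hx hz, lie_zero, lie_zero, sub_zero]

lemma iSupIndep_rootSpace :
    iSupIndep fun χ : H → ℂ ↦ (rootSpace H χ).toSubmodule :=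
  LieSubmodule.iSupIndep_toSubmodule.2 (iSupIndep_genWeightSpace ℂ H L)

lemma rootSpace_zero_toSubmodule : (rootSpace H (0 : H → ℂ)).toSubmodule = H.toSubmodule := by
  rw [rootSpace_zero_eq]
  rfl

lemma root_coe_injective {φ γ : H.root}
    (h : ((φ : Weight ℂ H L) : H → ℂ) = ((γ : Weight ℂ H L) : H → ℂ)) : φ = γ :=
  Subtype.ext (DFunLike.coe_injective h)

lemma rootSum_eq (Φ : Set H.root) :
    rootSum Φ = ⨆ χ ∈ (fun φ : H.root ↦ ((φ : Weight ℂ H L) : H → ℂ)) '' Φ,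
      (rootSpace H χ).toSubmodule := by
  rw [iSup_image]
  rfl

lemma cartan_sup_rootSum_eq (Φ : Set H.root) :
    H.toSubmodule ⊔ rootSum Φ =
      ⨆ χ ∈ insert (0 : H → ℂ) ((fun φ : H.root ↦ ((φ : Weight ℂ H L) : H → ℂ)) '' Φ),
        (rootSpace H χ).toSubmodule := by
  rw [iSup_insert, rootSum_eq, rootSpace_zero_toSubmodule]

lemma rootSub_le_rootSum {φ : H.root} {Φ : Set H.root} (h : φ ∈ Φ) : rootSub φ ≤ rootSum Φ :=
  le_iSup₂_of_le φ h le_rfl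

lemma rootSum_le_iff {Φ : Set H.root} {W : Submodule ℂ L} :
    rootSum Φ ≤ W ↔ ∀ φ ∈ Φ, rootSub φ ≤ W := by
  simp only [rootSum, iSup_le_iff]

lemma rootSum_mono {Φ Ψ : Set H.root} (h : Φ ⊆ Ψ) : rootSum Φ ≤ rootSum Ψ :=
  biSup_mono h

lemma rootSum_induction {Φ : Set H.root} {p : L → Prop}
    (mem : ∀ φ ∈ Φ, ∀ x ∈ rootSub φ, p x) (zero : p 0) (add : ∀ x y, p x → p y → p (x + y))
    {x : L} (hx : x ∈ rootSum Φ) : p x := by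
  rw [rootSum, iSup_subtype'] at hx
  exact Submodule.iSup_induction _ (motive := p) hx (fun φ x hx ↦ mem φ φ.2 x hx) zero add

lemma disjoint_cartan_rootSum (Φ : Set H.root) : Disjoint H.toSubmodule (rootSum Φ) := by
  rw [rootSum_eq, ← rootSpace_zero_toSubmodule]
  refine iSupIndep_rootSpace.disjoint_biSup ?_
  rintro ⟨φ, -, hφ⟩
  exact H.isNonZero_coe_root φ hφ

/-- Weight spaces are independent, so a sum of root spaces remembers its set of roots, even after
adding the Cartan subalgebra. -/
lemma mem_of_rootSub_le {φ : H.root} {Φ : Set H.root}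
    (h : rootSub φ ≤ H.toSubmodule ⊔ rootSum Φ) : φ ∈ Φ := by
  by_contra hφ
  rw [cartan_sup_rootSum_eq] at h
  refine rootSub_ne_bot φ (disjoint_self.1 (Disjoint.mono_right h ?_))
  refine iSupIndep_rootSpace.disjoint_biSup ?_
  rintro (h0 | ⟨γ, hγ, h0⟩)
  · exact H.isNonZero_coe_root φ h0
  · exact hφ (root_coe_injective h0 ▸ hγ)

lemma rootSub_le_rootSum_iff {φ : H.root} {Φ : Set H.root} : rootSub φ ≤ rootSum Φ ↔ φ ∈ Φ :=
  ⟨fun h ↦ mem_of_rootSub_le (h.trans le_sup_right), rootSub_le_rootSum⟩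

lemma rootSub_le_cartan_sup_iff {φ : H.root} {Φ : Set H.root} :
    rootSub φ ≤ H.toSubmodule ⊔ rootSum Φ ↔ φ ∈ Φ :=
  ⟨mem_of_rootSub_le, fun h ↦ (rootSub_le_rootSum h).trans le_sup_right⟩

/-- A subspace stable under the Cartan subalgebra is the sum of its intersection with the Cartan
subalgebra and the root spaces it contains. -/
lemma eq_inf_cartan_sup_rootSum {W : Submodule ℂ L} (hW : ∀ h ∈ H, ∀ x ∈ W, ⁅h, x⁆ ∈ W) :
    W = (W ⊓ H.toSubmodule) ⊔ rootSum {φ : H.root | rootSub φ ≤ W} := by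
  refine le_antisymm ?_ (sup_le inf_le_left (rootSum_le_iff.2 fun _ h ↦ h))
  let N : LieSubmodule ℂ H L := { W with lie_mem := fun {h x} hx ↦ hW h h.2 x hx }
  have hN : W = ⨆ χ : Weight ℂ H L, W ⊓ (rootSpace H χ).toSubmodule := by
    have := congrArg LieSubmodule.toSubmodule (eq_iSup_inf_genWeightSpace (N := N))
    rw [LieSubmodule.iSup_toSubmodule] at this
    exact this
  conv_lhs => rw [hN]
  refine iSup_le fun χ ↦ ?_
  by_cases hχ : χ.IsZero
  · rw [show (χ : H → ℂ) = 0 from hχ, rootSpace_zero_toSubmodule]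
    exact le_sup_left
  · intro x hx
    by_cases hx0 : x = 0
    · rw [hx0]; exact zero_mem _
    let φ : H.root := ⟨χ, by simpa [LieSubalgebra.root] using hχ⟩
    -- Root spaces are lines, so one that meets `W` nontrivially is contained in it.
    have hφ : rootSub φ ≤ W := rootSub_le_of_mem (φ := φ) hx.2 hx0 hx.1
    exact Submodule.mem_sup_right (rootSub_le_rootSum (φ := φ) hφ hx.2)

lemma eq_rootSum_of_inf_cartan {W : Submodule ℂ L} (hW : ∀ h ∈ H, ∀ x ∈ W, ⁅h, x⁆ ∈ W)
    (h : W ⊓ H.toSubmodule = ⊥) : W = rootSum {φ : H.root | rootSub φ ≤ W} := by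
  conv_lhs => rw [eq_inf_cartan_sup_rootSum hW, h, bot_sup_eq]

lemma eq_cartan_sup_rootSum {W : Submodule ℂ L} (hW : ∀ h ∈ H, ∀ x ∈ W, ⁅h, x⁆ ∈ W)
    (h : H.toSubmodule ≤ W) : W = H.toSubmodule ⊔ rootSum {φ : H.root | rootSub φ ≤ W} := by
  conv_lhs => rw [eq_inf_cartan_sup_rootSum hW, inf_eq_right.2 h]

lemma lie_mem_rootSub_of_mem_cartan {φ : H.root} {h x : L} (hh : h ∈ H) (hx : x ∈ rootSub φ) :
    ⁅h, x⁆ ∈ rootSub φ := by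
  rw [show ⁅h, x⁆ = _ from mem_rootSub_iff.1 hx ⟨h, hh⟩]
  exact Submodule.smul_mem _ _ hx

lemma lie_mem_rootSum_of_mem_cartan {Φ : Set H.root} {h x : L} (hh : h ∈ H)
    (hx : x ∈ rootSum Φ) : ⁅h, x⁆ ∈ rootSum Φ := by
  refine rootSum_induction (p := fun x ↦ ⁅h, x⁆ ∈ rootSum Φ) ?_ ?_ ?_ hx
  · exact fun φ hφ x hx ↦ rootSub_le_rootSum hφ (lie_mem_rootSub_of_mem_cartan hh hx)
  · simp
  · intro x y hx hy
    rw [lie_add]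
    exact add_mem hx hy

/-- Brackets of sums of root spaces, when no sum of roots vanishes. -/
lemma lie_mem_rootSum {Φ Ψ Θ : Set H.root}
    (h0 : ∀ φ ∈ Φ, ∀ γ ∈ Ψ, (rootSystem H).root φ + (rootSystem H).root γ ≠ 0)
    (h : ∀ φ ∈ Φ, ∀ γ ∈ Ψ, ∀ η, (rootSystem H).root η =
      (rootSystem H).root φ + (rootSystem H).root γ → η ∈ Θ)
    {x y : L} (hx : x ∈ rootSum Φ) (hy : y ∈ rootSum Ψ) : ⁅x, y⁆ ∈ rootSum Θ := by
  refine rootSum_induction (p := fun x ↦ ⁅x, y⁆ ∈ rootSum Θ) ?_ ?_ ?_ hx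
  · intro φ hφ x hx
    refine rootSum_induction (p := fun y ↦ ⁅x, y⁆ ∈ rootSum Θ) ?_ ?_ ?_ hy
    · intro γ hγ y hy
      by_cases hr : (rootSystem H).root φ + (rootSystem H).root γ ∈ Set.range (rootSystem H).root
      · obtain ⟨η, hη⟩ := hr
        exact rootSub_le_rootSum (h φ hφ γ hγ η hη) (lie_mem_rootSub hη hx hy)
      · rw [lie_eq_zero_of_add_notMem (h0 φ hφ γ hγ) hr hx hy]
        exact zero_mem _
    · simp
    · intro y z hy hz
      rw [lie_add]
      exact add_mem hy hz
  · simp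
  · intro y z hy hz
    rw [add_lie]
    exact add_mem hy hz

end RootSpaces

/-! ### Coefficients of roots at the simple roots, and uniqueness of the highest root -/

section Coefficients

variable {L : Type*} [LieRing L] [LieAlgebra ℂ L] [FiniteDimensional ℂ L] [IsKilling ℂ L]
variable {H : LieSubalgebra ℂ L} [H.IsCartanSubalgebra]

open IsKilling RootPairing

/-- The fundamental coweights: the basis of the Cartan subalgebra dual to the simple roots. -/
def fundCoweight (b : (rootSystem H).Base) (α : b.support) : H :=
  (Module.evalEquiv ℂ H).symm (b.toWeightBasis.coord α)

variable (b : (rootSystem H).Base)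

lemma apply_fundCoweight (f : Module.Dual ℂ H) (α : b.support) :
    f (fundCoweight b α) = b.toWeightBasis.repr f α := by
  rw [fundCoweight, Module.apply_evalEquiv_symm_apply]
  rfl

lemma root_eq_sum_simpleCoeff (φ : H.root) :
    (rootSystem H).root φ = ∑ α : b.support, simpleCoeff b φ α • (rootSystem H).root α := by
  have h := congrArg Subtype.val
    (b.toWeightBasisInt.sum_repr ((rootSystem H).rootSpanMem ℤ φ))
  rw [Submodule.coe_sum] at h
  simp only [Submodule.coe_smul, Base.coe_toWeightBasisInt_apply] at h
  exact h.symm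

open scoped Classical in
lemma simple_apply_fundCoweight (α β : b.support) :
    (rootSystem H).root α (fundCoweight b β) = if α = β then 1 else 0 := by
  rw [apply_fundCoweight, Base.toWeightBasis_repr_root, Finsupp.single_apply]

/-- This turns linear relations between roots into relations between integer coefficients. -/
lemma root_apply_fundCoweight (φ : H.root) (α : b.support) :
    (rootSystem H).root φ (fundCoweight b α) = simpleCoeff b φ α := by
  rw [root_eq_sum_simpleCoeff b φ, LinearMap.sum_apply]
  simp only [LinearMap.smul_apply, simple_apply_fundCoweight]
  simp

variable {b} in
lemma simpleCoeff_add {φ γ η : H.root}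
    (h : (rootSystem H).root η = (rootSystem H).root φ + (rootSystem H).root γ) (α : b.support) :
    simpleCoeff b η α = simpleCoeff b φ α + simpleCoeff b γ α := by
  have := LinearMap.congr_fun h (fundCoweight b α)
  rw [LinearMap.add_apply, root_apply_fundCoweight, root_apply_fundCoweight,
    root_apply_fundCoweight] at this
  exact_mod_cast this

variable {b} in
lemma simpleCoeff_of_neg {φ γ : H.root}
    (h : (rootSystem H).root γ = -(rootSystem H).root φ) (α : b.support) :
    simpleCoeff b γ α = -simpleCoeff b φ α := by
  have := LinearMap.congr_fun h (fundCoweight b α)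
  rw [LinearMap.neg_apply, root_apply_fundCoweight, root_apply_fundCoweight] at this
  exact_mod_cast this

open scoped Classical in
lemma simpleCoeff_simple (α β : b.support) :
    simpleCoeff b (α : H.root) β = if α = β then 1 else 0 := by
  have := root_apply_fundCoweight b α β
  rw [simple_apply_fundCoweight] at this
  split_ifs at this ⊢ <;> exact_mod_cast this.symm

lemma exists_simpleCoeff_ne_zero (φ : H.root) : ∃ α, simpleCoeff b φ α ≠ 0 := by
  by_contra! h
  apply (rootSystem H).ne_zero φ
  rw [root_eq_sum_simpleCoeff b φ]
  simp [h]

lemma exists_root_eq_neg (φ : H.root) :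
    ∃ γ, (rootSystem H).root γ = -(rootSystem H).root φ :=
  ⟨(rootSystem H).reflectionPerm φ φ, by
    rw [root_reflectionPerm, reflection_apply_self]⟩

lemma exists_nat_apply_fundCoweight {x : Module.Dual ℂ H}
    (hx : x ∈ AddSubmonoid.closure ((rootSystem H).root '' b.support)) (α : b.support) :
    ∃ n : ℕ, x (fundCoweight b α) = n := by
  classical
  induction hx using AddSubmonoid.closure_induction with
  | mem x hx =>
    obtain ⟨β, hβ, rfl⟩ := hx
    refine ⟨if (⟨β, hβ⟩ : b.support) = α then 1 else 0, ?_⟩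
    rw [simple_apply_fundCoweight b ⟨β, hβ⟩ α]
    split_ifs <;> simp
  | zero => exact ⟨0, by simp⟩
  | add x y _ _ hx hy =>
    obtain ⟨n, hn⟩ := hx
    obtain ⟨k, hk⟩ := hy
    exact ⟨n + k, by rw [LinearMap.add_apply, hn, hk, Nat.cast_add]⟩

lemma simpleCoeff_nonneg_or_nonpos (φ : H.root) :
    (∀ α, 0 ≤ simpleCoeff b φ α) ∨ (∀ α, simpleCoeff b φ α ≤ 0) := by
  rcases b.root_mem_or_neg_mem φ with h | h
  · refine Or.inl fun α ↦ ?_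
    obtain ⟨n, hn⟩ := exists_nat_apply_fundCoweight b h α
    rw [root_apply_fundCoweight] at hn
    have : simpleCoeff b φ α = n := by exact_mod_cast hn
    lia
  · refine Or.inr fun α ↦ ?_
    obtain ⟨n, hn⟩ := exists_nat_apply_fundCoweight b h α
    rw [LinearMap.neg_apply, root_apply_fundCoweight] at hn
    have : -simpleCoeff b φ α = n := by exact_mod_cast hn
    lia

lemma height_eq_sum_simpleCoeff (φ : H.root) : b.height φ = ∑ α, simpleCoeff b φ α := by
  classical
  let f : H.root → ℤ := fun j ↦ if h : j ∈ b.support then simpleCoeff b φ ⟨j, h⟩ else 0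
  have hf : ∀ α : b.support, f α = simpleCoeff b φ α := fun α ↦ by simp [f]
  rw [Base.height_eq_sum (f := f), ← Finset.sum_coe_sort]
  · simp only [hf]
  · rw [← Finset.sum_coe_sort]
    simp only [hf]
    exact root_eq_sum_simpleCoeff b φ

variable {b} in
lemma isPos_iff_simpleCoeff_nonneg {φ : H.root} :
    b.IsPos φ ↔ ∀ α, 0 ≤ simpleCoeff b φ α := by
  obtain ⟨β, hβ⟩ := exists_simpleCoeff_ne_zero b φ
  rw [Base.isPos_iff', height_eq_sum_simpleCoeff]
  refine ⟨fun h ↦ ?_, fun h ↦ Finset.sum_nonneg fun α _ ↦ h α⟩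
  refine (simpleCoeff_nonneg_or_nonpos b φ).resolve_right fun hn ↦ ?_
  have := Finset.sum_lt_sum (fun α (_ : α ∈ Finset.univ) ↦ hn α)
    ⟨β, Finset.mem_univ _, lt_of_le_of_ne (hn β) hβ⟩
  simp only [Finset.sum_const_zero] at this
  lia

variable {b} in
lemma simpleCoeff_nonpos_of_not_isPos {φ : H.root} (h : ¬ b.IsPos φ) (α : b.support) :
    simpleCoeff b φ α ≤ 0 :=
  (simpleCoeff_nonneg_or_nonpos b φ).resolve_left
    (fun hp ↦ h (isPos_iff_simpleCoeff_nonneg.2 hp)) α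

variable {b} in
lemma add_ne_zero_of_isPos {φ γ : H.root} (hφ : b.IsPos φ) (hγ : b.IsPos γ) :
    (rootSystem H).root φ + (rootSystem H).root γ ≠ 0 := by
  intro h
  obtain ⟨β, hβ⟩ := exists_simpleCoeff_ne_zero b φ
  have h1 := simpleCoeff_of_neg (b := b) (eq_neg_of_add_eq_zero_right h) β
  have h2 := isPos_iff_simpleCoeff_nonneg.1 hφ β
  have h3 := isPos_iff_simpleCoeff_nonneg.1 hγ β
  lia

lemma isPos_simple (α : b.support) : b.IsPos (α : H.root) :=
  Base.isPos_of_mem_support α.2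

lemma pairingIn_eq_sum (φ γ : H.root) :
    (rootSystem H).pairingIn ℤ φ γ =
      ∑ α : b.support, simpleCoeff b φ α * (rootSystem H).pairingIn ℤ α γ := by
  have h : ∀ η, (((rootSystem H).pairingIn ℤ η γ : ℤ) : ℂ) =
      (rootSystem H).root η ((rootSystem H).coroot γ) := fun η ↦
    (rootSystem H).algebraMap_pairingIn ℤ η γ
  have h1 : (((rootSystem H).pairingIn ℤ φ γ : ℤ) : ℂ) =
      ((∑ α : b.support, simpleCoeff b φ α * (rootSystem H).pairingIn ℤ α γ : ℤ) : ℂ) := by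
    rw [Int.cast_sum, h, root_eq_sum_simpleCoeff b φ, LinearMap.sum_apply]
    simp only [Int.cast_mul, h]
    refine Finset.sum_congr rfl fun α _ ↦ ?_
    rw [LinearMap.smul_apply, zsmul_eq_mul]
  exact_mod_cast h1

/-! ### The highest root -/

/-- `φ` is a positive root such that `φ + α` is not a root for any simple root `α`. -/
structure IsTop (φ : H.root) : Prop where
  isPos : b.IsPos φ
  add_notMem : ∀ α : b.support,
    (rootSystem H).root φ + (rootSystem H).root α ∉ Set.range (rootSystem H).root

variable {b}

lemma pairingIn_neg_comm {φ γ : H.root} :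
    (rootSystem H).pairingIn ℤ φ γ < 0 ↔ (rootSystem H).pairingIn ℤ γ φ < 0 :=
  (rootSystem H).pairingIn_lt_zero_iff ℤ

lemma IsTop.pairingIn_nonneg {φ : H.root} (h : IsTop b φ) (α : b.support) :
    0 ≤ (rootSystem H).pairingIn ℤ φ α := by
  by_contra! hn
  refine h.add_notMem α ((rootSystem H).root_add_root_mem_of_pairingIn_neg hn fun he ↦ ?_)
  exact add_ne_zero_of_isPos h.isPos (isPos_simple b α) (by rw [he, neg_add_cancel])

lemma IsTop.pairingIn_nonneg' {φ : H.root} (h : IsTop b φ) (α : b.support) :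
    0 ≤ (rootSystem H).pairingIn ℤ α φ := by
  have := h.pairingIn_nonneg α
  by_contra! hn
  rw [pairingIn_neg_comm] at hn
  lia

/-- Positivity spreads along the connected Dynkin diagram: if the coefficient at `j` vanished while
that at a neighbour `i` were positive, then `φ` would pair negatively with `j`, and `φ + j` would be
a root. -/
lemma IsTop.simpleCoeff_pos [(rootSystem H).IsIrreducible] {φ : H.root} (h : IsTop b φ)
    (α : b.support) : 0 < simpleCoeff b φ α := by
  obtain ⟨β, hβ⟩ := exists_simpleCoeff_ne_zero b φ
  have hnn := isPos_iff_simpleCoeff_nonneg.1 h.isPos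
  refine b.induction_on_cartanMatrix (fun α ↦ 0 < simpleCoeff b φ α)
    (lt_of_le_of_ne (hnn β) hβ.symm) (fun i j hi hij ↦ ?_)
  by_contra hj
  have hj0 : simpleCoeff b φ j = 0 := le_antisymm (not_lt.1 hj) (hnn j)
  have hne : i ≠ j := by
    rintro rfl
    exact hj hi
  have hji : (rootSystem H).pairingIn ℤ (j : H.root) i < 0 :=
    lt_of_le_of_ne (b.pairingIn_le_zero_of_ne (fun e ↦ hne (Subtype.ext e.symm)) j.2 i.2) hij
  have key : (rootSystem H).pairingIn ℤ φ j < 0 := by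
    rw [pairingIn_eq_sum b]
    have := Finset.sum_lt_sum (s := Finset.univ)
      (f := fun α : b.support ↦ simpleCoeff b φ α * (rootSystem H).pairingIn ℤ α j)
      (g := fun _ ↦ 0) (fun α _ ↦ ?_) ⟨i, Finset.mem_univ _, ?_⟩
    · simpa using this
    · by_cases hα : α = j
      · simp [hα, hj0]
      · exact mul_nonpos_of_nonneg_of_nonpos (hnn α)
          (b.pairingIn_le_zero_of_ne (fun e ↦ hα (Subtype.ext e)) α.2 j.2)
    · exact mul_neg_of_pos_of_neg hi (pairingIn_neg_comm.1 hji)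
  exact absurd (h.pairingIn_nonneg j) (not_le.2 key)

/-- Induction building `γ` up by simple roots: if `φ + i + j` is a root, Jacobi makes `φ + i` or `φ
+ j` a root. -/
lemma IsTop.add_isPos_notMem {φ : H.root} (h : IsTop b φ) {γ : H.root} (hγ : b.IsPos γ) :
    (rootSystem H).root φ + (rootSystem H).root γ ∉ Set.range (rootSystem H).root := by
  suffices b.IsPos γ ∧
      (rootSystem H).root φ + (rootSystem H).root γ ∉ Set.range (rootSystem H).root from this.2
  refine Base.IsPos.induction_on_add (p := fun γ ↦ b.IsPos γ ∧
    (rootSystem H).root φ + (rootSystem H).root γ ∉ Set.range (rootSystem H).root) hγ ?_ ?_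
  · exact fun i hi ↦ ⟨isPos_simple b ⟨i, hi⟩, h.add_notMem ⟨i, hi⟩⟩
  · rintro i j k hk ⟨hi, hi'⟩ hj
    refine ⟨hi.add (isPos_simple b ⟨j, hj⟩) hk, ?_⟩
    rintro ⟨τ, hτ⟩
    rcases add_mem_range_or_add_mem_range hk (hτ.trans (add_comm _ _))
      (add_ne_zero_of_isPos (isPos_simple b ⟨j, hj⟩) h.isPos)
      (add_ne_zero_of_isPos hi h.isPos) with h1 | h1
    · exact h.add_notMem ⟨j, hj⟩ (by rwa [add_comm])
    · exact hi' (by rwa [add_comm])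

lemma IsTop.pairingIn_pos [(rootSystem H).IsIrreducible] {φ ψ : H.root} (hφ : IsTop b φ)
    (hψ : IsTop b ψ) : 0 < (rootSystem H).pairingIn ℤ φ ψ := by
  obtain ⟨j, hj, hpos⟩ := hψ.isPos.exists_mem_support_pos_pairingIn
  rw [pairingIn_eq_sum b]
  refine Finset.sum_pos' (fun α _ ↦ ?_) ⟨⟨j, hj⟩, Finset.mem_univ _, ?_⟩
  · exact mul_nonneg (hφ.simpleCoeff_pos α).le (hψ.pairingIn_nonneg' α)
  · exact mul_pos (hφ.simpleCoeff_pos _) hpos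

/-- Two distinct top roots pair positively, so their difference is a root; whichever sign makes it
positive, adding it to one of them gives the other, against `IsTop.add_isPos_notMem`. -/
lemma IsTop.eq [(rootSystem H).IsIrreducible] {φ ψ : H.root} (hφ : IsTop b φ)
    (hψ : IsTop b ψ) : φ = ψ := by
  by_contra hne
  obtain ⟨σ, hσ⟩ := (rootSystem H).root_sub_root_mem_of_pairingIn_pos (hφ.pairingIn_pos hψ) hne
  by_cases hp : b.IsPos σ
  · exact hψ.add_isPos_notMem hp ⟨φ, by rw [hσ]; abel⟩
  · obtain ⟨τ, hτ⟩ := exists_root_eq_neg σ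
    have hτp : b.IsPos τ := isPos_iff_simpleCoeff_nonneg.2 fun α ↦ by
      rw [simpleCoeff_of_neg hτ]
      have := simpleCoeff_nonpos_of_not_isPos hp α
      lia
    exact hφ.add_isPos_notMem hτp ⟨ψ, by rw [hτ, hσ]; abel⟩

lemma exists_isTop_ge {φ : H.root} (hφ : b.IsPos φ) :
    ∃ τ, IsTop b τ ∧ ∀ α, simpleCoeff b φ α ≤ simpleCoeff b τ α := by
  classical
  obtain ⟨τ, hτ, hmax⟩ := Finset.exists_max_image
    (Finset.univ.filter fun τ : H.root ↦ ∀ α, simpleCoeff b φ α ≤ simpleCoeff b τ α)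
    b.height ⟨φ, by
      rw [Finset.mem_filter]
      exact ⟨Finset.mem_univ _, fun _ ↦ le_rfl⟩⟩
  simp only [Finset.mem_filter, Finset.mem_univ, true_and] at hτ hmax
  refine ⟨τ, ⟨isPos_iff_simpleCoeff_nonneg.2 fun α ↦
    (isPos_iff_simpleCoeff_nonneg.1 hφ α).trans (hτ α), ?_⟩, hτ⟩
  rintro α ⟨η, hη⟩
  have h1 := hmax η fun β ↦ by
    rw [simpleCoeff_add hη]
    have := isPos_iff_simpleCoeff_nonneg.1 (isPos_simple b α) β
    have := hτ β
    lia
  rw [b.height_add hη, Base.height_one_of_mem_support α.2] at h1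
  lia

lemma sub_mem_closure {φ ψ : H.root} (h : ∀ α, simpleCoeff b ψ α ≤ simpleCoeff b φ α) :
    (rootSystem H).root φ - (rootSystem H).root ψ ∈
      AddSubmonoid.closure ((rootSystem H).root '' b.support) := by
  rw [root_eq_sum_simpleCoeff b φ, root_eq_sum_simpleCoeff b ψ, ← Finset.sum_sub_distrib]
  refine sum_mem fun α _ ↦ ?_
  have hα : (rootSystem H).root α ∈
      AddSubmonoid.closure ((rootSystem H).root '' b.support) :=
    AddSubmonoid.subset_closure ⟨α, α.2, rfl⟩
  rw [← sub_smul, ← Int.toNat_of_nonneg (sub_nonneg.2 (h α)), natCast_zsmul]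
  exact nsmul_mem hα _

lemma IsHighestRoot.isTop {ψ : H.root} (hψ : IsHighestRoot b ψ) : IsTop b ψ where
  isPos := by
    by_contra hn
    have h1 := simpleCoeff_nonpos_of_not_isPos hn
    obtain ⟨τ, hτ⟩ := exists_root_eq_neg ψ
    have h2 := simpleCoeff_of_neg (b := b) hτ
    have : τ = ψ := hψ τ (sub_mem_closure fun α ↦ by
      have := h1 α
      have := h2 α
      lia)
    subst this
    exact hn (isPos_iff_simpleCoeff_nonneg.2 fun α ↦ by have := h2 α; lia)
  add_notMem := by
    rintro α ⟨η, hη⟩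
    have : η = ψ := hψ η (by
      rw [hη, add_sub_cancel_left]
      exact AddSubmonoid.subset_closure ⟨α, α.2, rfl⟩)
    subst this
    exact (rootSystem H).ne_zero α (by simp at hη)

/-- A highest root is only assumed maximal. It is greatest because every positive root lies below
some top root and there is only one. -/
lemma IsHighestRoot.simpleCoeff_le [(rootSystem H).IsIrreducible] {ψ : H.root}
    (hψ : IsHighestRoot b ψ) (φ : H.root) (α : b.support) :
    simpleCoeff b φ α ≤ simpleCoeff b ψ α := by
  by_cases hφ : b.IsPos φ
  · obtain ⟨τ, hτ, hle⟩ := exists_isTop_ge hφ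
    rw [hτ.eq hψ.isTop] at hle
    exact hle α
  · exact (simpleCoeff_nonpos_of_not_isPos hφ α).trans (hψ.isTop.simpleCoeff_pos α).le

end Coefficients

/-! ### Outer height, raising roots, and irreducibility of the fibers -/

section OuterHeight

variable {L : Type*} [LieRing L] [LieAlgebra ℂ L] [FiniteDimensional ℂ L] [IsKilling ℂ L]
variable {H : LieSubalgebra ℂ L} [H.IsCartanSubalgebra]

open IsKilling RootPairing

variable (b : (rootSystem H).Base) (S : b.support → Prop)

/-- The sum of the coefficients of a root at the simple roots outside `S`. -/
def outerHeight (φ : H.root) : ℤ :=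
  open Classical in ∑ α : b.support with ¬ S α, simpleCoeff b φ α

/-- The two roots have the same coefficients at the simple roots outside `S`. -/
def SameOuter (φ γ : H.root) : Prop := ∀ α, ¬ S α → simpleCoeff b φ α = simpleCoeff b γ α

variable {b S}

lemma SameOuter.outerHeight_eq {φ γ : H.root} (h : SameOuter b S φ γ) :
    outerHeight b S φ = outerHeight b S γ := by
  classical
  exact Finset.sum_congr rfl fun α hα ↦ h α (by simpa using hα)

lemma outerHeight_add {φ γ η : H.root}
    (h : (rootSystem H).root η = (rootSystem H).root φ + (rootSystem H).root γ) :
    outerHeight b S η = outerHeight b S φ + outerHeight b S γ := by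
  classical
  rw [outerHeight, outerHeight, outerHeight, ← Finset.sum_add_distrib]
  exact Finset.sum_congr rfl fun α _ ↦ simpleCoeff_add h α

lemma outerHeight_of_neg {φ γ : H.root}
    (h : (rootSystem H).root γ = -(rootSystem H).root φ) :
    outerHeight b S γ = -outerHeight b S φ := by
  classical
  rw [outerHeight, outerHeight, ← Finset.sum_neg_distrib]
  exact Finset.sum_congr rfl fun α _ ↦ simpleCoeff_of_neg h α

lemma outerHeight_simple_of_mem {α : b.support} (h : S α) : outerHeight b S α = 0 := by
  classical
  refine Finset.sum_eq_zero fun β hβ ↦ ?_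
  rw [simpleCoeff_simple, if_neg]
  rintro rfl
  simp [h] at hβ

lemma outerHeight_simple_of_notMem {α : b.support} (h : ¬ S α) : outerHeight b S α = 1 := by
  classical
  rw [outerHeight, Finset.sum_eq_single α]
  · rw [simpleCoeff_simple, if_pos rfl]
  · intro β _ hβ
    rw [simpleCoeff_simple, if_neg hβ.symm]
  · simp [h]

lemma outerHeight_nonneg {φ : H.root} (h : b.IsPos φ) : 0 ≤ outerHeight b S φ :=
  Finset.sum_nonneg fun α _ ↦ isPos_iff_simpleCoeff_nonneg.1 h α

lemma outerHeight_nonpos {φ : H.root} (h : ¬ b.IsPos φ) : outerHeight b S φ ≤ 0 :=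
  Finset.sum_nonpos fun α _ ↦ simpleCoeff_nonpos_of_not_isPos h α

lemma isPos_of_outerHeight_pos {φ : H.root} (h : 0 < outerHeight b S φ) : b.IsPos φ := by
  by_contra hn
  exact absurd (outerHeight_nonpos (S := S) hn) (not_le.2 h)

lemma simpleCoeff_eq_zero_of_outerHeight_eq_zero {φ : H.root} (h : outerHeight b S φ = 0)
    {α : b.support} (hα : ¬ S α) : simpleCoeff b φ α = 0 := by
  classical
  rcases simpleCoeff_nonneg_or_nonpos b φ with hp | hn
  · exact (Finset.sum_eq_zero_iff_of_nonneg fun α _ ↦ hp α).1 h α (by simpa using hα)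
  · exact (Finset.sum_eq_zero_iff_of_nonpos fun α _ ↦ hn α).1 h α (by simpa using hα)

lemma outerHeight_eq_zero_of_simpleCoeff {φ : H.root} (h : ∀ α, ¬ S α → simpleCoeff b φ α = 0) :
    outerHeight b S φ = 0 := by
  classical
  exact Finset.sum_eq_zero fun α hα ↦ h α (by simpa using hα)

lemma outerHeight_eq_zero_of_add {φ γ η : H.root}
    (h : (rootSystem H).root η = (rootSystem H).root φ + (rootSystem H).root γ)
    (hs : SameOuter b S η φ) : outerHeight b S γ = 0 := by
  have := outerHeight_add (b := b) (S := S) h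
  rw [hs.outerHeight_eq] at this
  lia

lemma add_ne_zero_of_outerHeight {φ γ : H.root} (h : outerHeight b S φ + outerHeight b S γ ≠ 0) :
    (rootSystem H).root φ + (rootSystem H).root γ ≠ 0 := by
  intro h0
  have := outerHeight_of_neg (b := b) (S := S) (eq_neg_of_add_eq_zero_right h0)
  lia

lemma IsHighestRoot.outerHeight_le [(rootSystem H).IsIrreducible] {ψ : H.root}
    (hψ : IsHighestRoot b ψ) (φ : H.root) : outerHeight b S φ ≤ outerHeight b S ψ :=
  Finset.sum_le_sum fun α _ ↦ hψ.simpleCoeff_le φ α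

lemma IsHighestRoot.sameOuter [(rootSystem H).IsIrreducible] {ψ : H.root}
    (hψ : IsHighestRoot b ψ) {φ : H.root} (h : outerHeight b S φ = outerHeight b S ψ) :
    SameOuter b S φ ψ := by
  classical
  intro α hα
  exact (Finset.sum_eq_sum_iff_of_le fun α _ ↦ hψ.simpleCoeff_le φ α).1 h α (by simpa using hα)

/-- A root of outer height `1` has the coefficients outside `S` of a simple root. -/
lemma exists_simple_sameOuter {γ : H.root} (h : outerHeight b S γ = 1) :
    ∃ α : b.support, ¬ S α ∧ SameOuter b S γ α := by
  classical
  have hnn := isPos_iff_simpleCoeff_nonneg.1 (isPos_of_outerHeight_pos (S := S) (φ := γ) (by lia))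
  obtain ⟨α, hα, hne⟩ := Finset.exists_ne_zero_of_sum_ne_zero
    (show outerHeight b S γ ≠ 0 by lia)
  have hα' : ¬ S α := by simpa using hα
  have h1 := Finset.add_sum_erase _ (simpleCoeff b γ) hα
  have h2 : outerHeight b S γ =
    ∑ α ∈ Finset.univ.filter fun α ↦ ¬ S α, simpleCoeff b γ α := rfl
  rw [← h2, h] at h1
  have h3 : 0 ≤ ∑ β ∈ (Finset.univ.filter fun α ↦ ¬ S α).erase α, simpleCoeff b γ β :=
    Finset.sum_nonneg fun β _ ↦ hnn β
  have h4 := hnn α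
  refine ⟨α, hα', fun β hβ ↦ ?_⟩
  rw [simpleCoeff_simple]
  split_ifs with he
  · subst he
    lia
  -- Nonnegative integers with sum `1`, one of them nonzero: the others vanish.
  · have h5 : ∑ β ∈ (Finset.univ.filter fun α ↦ ¬ S α).erase α, simpleCoeff b γ β = 0 := by lia
    exact (Finset.sum_eq_zero_iff_of_nonneg fun β _ ↦ hnn β).1 h5 β
      (Finset.mem_erase.2 ⟨Ne.symm he, by simpa using hβ⟩)

/-- Below the top layer, every root can be raised by a root of outer height `1`. -/
lemma IsHighestRoot.exists_add_mem [(rootSystem H).IsIrreducible] {ψ : H.root}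
    (hψ : IsHighestRoot b ψ) {φ : H.root} (h0 : 0 < outerHeight b S φ)
    (h1 : outerHeight b S φ < outerHeight b S ψ) :
    ∃ γ, outerHeight b S γ = 1 ∧
      (rootSystem H).root φ + (rootSystem H).root γ ∈ Set.range (rootSystem H).root := by
  classical
  by_contra hcon
  -- Take a counterexample `τ` of largest height. It is not the top root, so `τ + α` is a root for
  -- some simple `α`; outside `S`, this `α` already raises `τ`.
  obtain ⟨τ, hτ, hmax⟩ := Finset.exists_max_image
    (Finset.univ.filter fun τ : H.root ↦ (0 < outerHeight b S τ ∧
      outerHeight b S τ < outerHeight b S ψ) ∧ ¬ ∃ γ, outerHeight b S γ = 1 ∧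
      (rootSystem H).root τ + (rootSystem H).root γ ∈ Set.range (rootSystem H).root)
    b.height ⟨φ, by
      rw [Finset.mem_filter]
      exact ⟨Finset.mem_univ _, ⟨h0, h1⟩, hcon⟩⟩
  simp only [Finset.mem_filter, Finset.mem_univ, true_and] at hτ hmax
  obtain ⟨⟨ho, ho'⟩, hno⟩ := hτ
  have hnt : ¬ IsTop b τ := fun ht ↦ by
    rw [ht.eq hψ.isTop] at ho'
    exact lt_irrefl _ ho'
  obtain ⟨α, η, hη⟩ : ∃ α : b.support,
      (rootSystem H).root τ + (rootSystem H).root α ∈ Set.range (rootSystem H).root := by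
    by_contra! hh
    exact hnt ⟨isPos_of_outerHeight_pos ho, hh⟩
  by_cases hα : S α
  · have hoη := outerHeight_add (b := b) (S := S) hη
    have hoα := outerHeight_simple_of_mem hα
    have hex : ∃ γ, outerHeight b S γ = 1 ∧
        (rootSystem H).root η + (rootSystem H).root γ ∈ Set.range (rootSystem H).root := by
      by_contra hh
      have := hmax η ⟨⟨by lia, by lia⟩, hh⟩
      rw [b.height_add hη, Base.height_one_of_mem_support α.2] at this
      lia
    obtain ⟨γ, hγ, θ, hθ⟩ := hex
    -- Here `α` lies in `S`, so `η = τ + α` has the same outer height and, by maximality, is raised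
    -- by some `γ`. Jacobi then lets `α + γ` or `γ` raise `τ`, and both have outer height `1`.
    rcases add_mem_range_or_add_mem_range hη hθ
      (add_ne_zero_of_outerHeight (b := b) (S := S) (by lia))
      (add_ne_zero_of_outerHeight (b := b) (S := S) (by lia)) with ⟨κ, hκ⟩ | h2
    · refine hno ⟨κ, ?_, θ, ?_⟩
      · rw [outerHeight_add hκ]
        lia
      · rw [hθ, hη, hκ, add_assoc]
    · exact hno ⟨γ, hγ, h2⟩
  · exact hno ⟨α, outerHeight_simple_of_notMem hα, η, hη⟩

/-- Repeated raising from a simple root outside `S` meets every layer; this makes the central series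
strict. -/
lemma IsHighestRoot.exists_outerHeight_eq [(rootSystem H).IsIrreducible] {ψ : H.root}
    (hψ : IsHighestRoot b ψ) {α : b.support} (hα : ¬ S α) {k : ℕ} (hk : 1 ≤ k)
    (hk' : (k : ℤ) ≤ outerHeight b S ψ) : ∃ φ, outerHeight b S φ = k := by
  induction k, hk using Nat.le_induction with
  | base => exact ⟨α, outerHeight_simple_of_notMem hα⟩
  | succ k hk ih =>
    push_cast at hk'
    obtain ⟨φ, hφ⟩ := ih (by lia)
    obtain ⟨γ, hγ, η, hη⟩ := hψ.exists_add_mem (S := S) (φ := φ) (by lia) (by lia)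
    exact ⟨η, by rw [outerHeight_add hη, hφ, hγ]; simp⟩

/-! ### Roots with prescribed coefficients outside `S` -/

/-- The canonical invariant form on roots, with integral values. -/
def intForm (φ γ : H.root) : ℤ :=
  ∑ i : H.root, (rootSystem H).pairingIn ℤ φ i * (rootSystem H).pairingIn ℤ γ i

lemma intForm_cast (φ γ : H.root) : ((intForm φ γ : ℤ) : ℂ) =
    (rootSystem H).RootForm ((rootSystem H).root φ) ((rootSystem H).root γ) := by
  rw [rootForm_apply_apply, intForm, Int.cast_sum]
  refine Finset.sum_congr rfl fun i _ ↦ ?_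
  rw [Int.cast_mul, root_coroot'_eq_pairing, root_coroot'_eq_pairing,
    ← (rootSystem H).algebraMap_pairingIn ℤ, ← (rootSystem H).algebraMap_pairingIn ℤ]
  rfl

lemma two_mul_intForm (φ γ : H.root) :
    2 * intForm φ γ = (rootSystem H).pairingIn ℤ φ γ * intForm γ γ := by
  have hc : ((rootSystem H).pairingIn ℤ φ γ : ℂ) = (rootSystem H).pairing φ γ :=
    (rootSystem H).algebraMap_pairingIn ℤ φ γ
  have h := ((rootSystem H).posRootForm ℤ).two_mul_apply_root_root φ γ
  have h1 : ((rootSystem H).posRootForm ℤ).form = (rootSystem H).RootForm := rfl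
  rw [h1, ← intForm_cast, ← intForm_cast, ← hc] at h
  exact_mod_cast h

lemma intForm_self_nonneg (φ : H.root) : 0 ≤ intForm φ φ :=
  Finset.sum_nonneg fun _ _ ↦ mul_self_nonneg _

/-- The pairing is additive only in its first argument. The symmetric form is additive in both, and
`two_mul_intForm` transfers signs between the two. -/
lemma intForm_eq_sum (b : (rootSystem H).Base) (φ γ : H.root) :
    intForm φ γ = ∑ α : b.support, simpleCoeff b γ α * intForm φ α := by
  simp only [intForm, Finset.mul_sum]
  rw [Finset.sum_comm]
  refine Finset.sum_congr rfl fun i _ ↦ ?_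
  rw [pairingIn_eq_sum b γ i, Finset.mul_sum]
  exact Finset.sum_congr rfl fun α _ ↦ by ring

/-- The double sum is a sum of squares of the values of `∑ φ ∈ V, φ` at the coroots, and coroots
span. -/
lemma sum_root_eq_zero_of_intForm {V : Finset H.root}
    (h : ∑ φ ∈ V, ∑ γ ∈ V, intForm φ γ ≤ 0) : ∑ φ ∈ V, (rootSystem H).root φ = 0 := by
  have h1 : ∑ φ ∈ V, ∑ γ ∈ V, intForm φ γ =
      ∑ i : H.root, (∑ φ ∈ V, (rootSystem H).pairingIn ℤ φ i) ^ 2 := by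
    simp only [intForm, sq, Finset.sum_mul_sum]
    rw [Finset.sum_comm (s := Finset.univ)]
    exact Finset.sum_congr rfl fun φ _ ↦ Finset.sum_comm
  rw [h1] at h
  have h2 := (Finset.sum_eq_zero_iff_of_nonneg fun i _ ↦ sq_nonneg _).1
    (le_antisymm h (Finset.sum_nonneg fun i _ ↦ sq_nonneg _))
  refine LinearMap.ext_on (IsRootSystem.span_coroot_eq_top (P := rootSystem H)) ?_
  rintro _ ⟨i, rfl⟩
  have h3 : ((∑ φ ∈ V, (rootSystem H).pairingIn ℤ φ i : ℤ) : ℂ) = 0 := by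
    exact_mod_cast pow_eq_zero_iff (two_ne_zero) |>.1 (h2 i (Finset.mem_univ _))
  rw [LinearMap.sum_apply, LinearMap.zero_apply, ← h3, Int.cast_sum]
  exact Finset.sum_congr rfl fun φ _ ↦ ((rootSystem H).algebraMap_pairingIn ℤ φ i).symm

/-- Root strings are unbroken and reach down at least `pairingIn ℤ φ σ` steps, so `φ - n σ` is
reached inside `V` by adding `-σ` one step at a time. -/
lemma exists_sub_nsmul_mem {V : Set H.root}
    (hV : ∀ φ ∈ V, ∀ σ, outerHeight b S σ = 0 → ∀ η,
      (rootSystem H).root η = (rootSystem H).root φ + (rootSystem H).root σ → η ∈ V)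
    {φ σ : H.root} (hφ : φ ∈ V) (hφ0 : outerHeight b S φ ≠ 0) (hσ : outerHeight b S σ = 0)
    {n : ℕ} (hn : (n : ℤ) ≤ (rootSystem H).pairingIn ℤ φ σ) :
    ∃ η ∈ V, (rootSystem H).root η = (rootSystem H).root φ - n • (rootSystem H).root σ := by
  have hli : LinearIndependent ℂ ![(rootSystem H).root σ, (rootSystem H).root φ] := by
    refine IsReduced.linearIndependent _ (fun h ↦ hφ0 (h ▸ hσ)) fun h ↦ hφ0 ?_
    have := outerHeight_of_neg (b := b) (S := S) h
    lia
  obtain ⟨σ', hσ'⟩ := exists_root_eq_neg σ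
  induction n with
  | zero => exact ⟨φ, hφ, by simp⟩
  | succ n ih =>
    push_cast at hn
    obtain ⟨η, hη, hη'⟩ := ih (by lia)
    obtain ⟨θ, hθ⟩ := ((rootSystem H).root_sub_nsmul_mem_range_iff_le_chainBotCoeff
      (n := n + 1) hli).2 (by
        have := (rootSystem H).chainBotCoeff_sub_chainTopCoeff hli
        lia)
    refine ⟨θ, hV η hη σ' (by rw [outerHeight_of_neg hσ', hσ, neg_zero]) θ ?_, hθ⟩
    rw [hθ, hη', hσ', succ_nsmul]
    abel

lemma reflectionPerm_mem {V : Set H.root}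
    (hV : ∀ φ ∈ V, ∀ σ, outerHeight b S σ = 0 → ∀ η,
      (rootSystem H).root η = (rootSystem H).root φ + (rootSystem H).root σ → η ∈ V)
    {φ σ : H.root} (hφ : φ ∈ V) (hφ0 : outerHeight b S φ ≠ 0) (hσ : outerHeight b S σ = 0) :
    (rootSystem H).reflectionPerm σ φ ∈ V := by
  have key : (rootSystem H).root ((rootSystem H).reflectionPerm σ φ) =
      (rootSystem H).root φ - (rootSystem H).pairingIn ℤ φ σ • (rootSystem H).root σ := by
    rw [root_reflectionPerm, reflection_apply_root' ℤ]
  rcases le_total 0 ((rootSystem H).pairingIn ℤ φ σ) with h | h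
  · obtain ⟨n, hn⟩ := Int.eq_ofNat_of_zero_le h
    obtain ⟨η, hη, hη'⟩ := exists_sub_nsmul_mem hV hφ hφ0 hσ hn.ge
    rw [hn, natCast_zsmul, ← hη'] at key
    rwa [(rootSystem H).root.injective key]
  · obtain ⟨n, hn⟩ := Int.eq_ofNat_of_zero_le (neg_nonneg.2 h)
    obtain ⟨σ', hσ'⟩ : ∃ σ', σ' = (rootSystem H).reflectionPerm σ σ := ⟨_, rfl⟩
    have hr : (rootSystem H).root σ' = -(rootSystem H).root σ := by
      rw [hσ', root_reflectionPerm, reflection_apply_self]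
    have hp : (rootSystem H).pairingIn ℤ φ σ' = -(rootSystem H).pairingIn ℤ φ σ := by
      rw [hσ', pairingIn_reflectionPerm_self_right]
    obtain ⟨η, hη, hη'⟩ := exists_sub_nsmul_mem hV hφ hφ0 (σ := σ')
      (by rw [outerHeight_of_neg hr, hσ, neg_zero]) (n := n) (by rw [hp, hn])
    rw [hr, smul_neg, sub_neg_eq_add] at hη'
    rw [← neg_neg ((rootSystem H).pairingIn ℤ φ σ), hn, neg_smul, natCast_zsmul,
      sub_neg_eq_add, ← hη'] at key
    rwa [(rootSystem H).root.injective key]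

/-- The roots with prescribed coefficients outside `S`, not all zero, form a single orbit under
adding roots of outer height zero: this is the irreducibility of the weight spaces of the center
of a Levi factor. -/
lemma mem_of_sameOuter {V : Set H.root}
    (hV : ∀ φ ∈ V, ∀ σ, outerHeight b S σ = 0 → ∀ η,
      (rootSystem H).root η = (rootSystem H).root φ + (rootSystem H).root σ → η ∈ V)
    {φ₀ : H.root} (hφ₀ : φ₀ ∈ V) (h0 : outerHeight b S φ₀ ≠ 0)
    (hsame : ∀ φ ∈ V, SameOuter b S φ φ₀) {γ : H.root} (hγ : SameOuter b S γ φ₀) : γ ∈ V := by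
  classical
  by_contra hγV
  have hne : ∀ φ ∈ V, outerHeight b S φ ≠ 0 := fun φ hφ ↦ by
    rwa [(hsame φ hφ).outerHeight_eq]
  -- Otherwise `φ - γ` is a root of outer height zero, and subtracting it from `φ` puts `γ` in `V`.
  have hle : ∀ φ ∈ V, (rootSystem H).pairingIn ℤ φ γ ≤ 0 := by
    intro φ hφ
    by_contra! hpos
    obtain ⟨σ, hσ⟩ := (rootSystem H).root_sub_root_mem_of_pairingIn_pos hpos
      (fun h ↦ hγV (h ▸ hφ))
    obtain ⟨σ', hσ'⟩ := exists_root_eq_neg σ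
    have h1 : (rootSystem H).root γ = (rootSystem H).root φ + (rootSystem H).root σ' := by
      rw [hσ', hσ]; abel
    refine hγV (hV φ hφ σ' (outerHeight_eq_zero_of_add h1 fun α hα ↦ ?_) γ h1)
    rw [hγ α hα, hsame φ hφ α hα]
  let W : Finset H.root := Finset.univ.filter (· ∈ V)
  have hW : ∀ φ, φ ∈ W ↔ φ ∈ V := fun φ ↦ by simp [W]
  -- The reflection in `σ` permutes `V` and changes the sign of the pairing with `σ`.
  have horth : ∀ σ, outerHeight b S σ = 0 → ∑ φ ∈ W, (rootSystem H).pairingIn ℤ φ σ = 0 := by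
    intro σ hσ
    have h1 : ∑ φ ∈ W, (rootSystem H).pairingIn ℤ φ σ =
        ∑ φ ∈ W, -(rootSystem H).pairingIn ℤ φ σ := by
      refine Finset.sum_equiv ((rootSystem H).reflectionPerm σ) (fun φ ↦ ?_) (fun φ _ ↦ ?_)
      · rw [hW, hW]
        refine ⟨fun h ↦ reflectionPerm_mem hV h (hne φ h) hσ, fun h ↦ ?_⟩
        have := reflectionPerm_mem hV h (hne _ h) hσ
        rwa [reflectionPerm_self] at this
      · rw [← pairingIn_reflectionPerm, pairingIn_reflectionPerm_self_right, neg_neg]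
    rw [Finset.sum_neg_distrib] at h1
    lia
  have hform : ∀ σ, outerHeight b S σ = 0 → ∑ φ ∈ W, intForm φ σ = 0 := by
    intro σ hσ
    have : 2 * ∑ φ ∈ W, intForm φ σ = 0 := by
      rw [Finset.mul_sum]
      simp only [two_mul_intForm]
      rw [← Finset.sum_mul, horth σ hσ, zero_mul]
    lia
  -- The sum of `V` is orthogonal to `S`, so its product with a root depends only on the
  -- coefficients outside `S`. On this fiber it equals the product with `γ`, which is `≤ 0`; summing
  -- over `V` gives a square norm `≤ 0`.
  have hconst : ∀ φ, SameOuter b S φ φ₀ →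
      ∑ θ ∈ W, intForm θ φ = ∑ θ ∈ W, intForm θ γ := by
    intro φ hφ
    simp only [intForm_eq_sum b _ φ, intForm_eq_sum b _ γ]
    rw [Finset.sum_comm, Finset.sum_comm (s := W)]
    refine Finset.sum_congr rfl fun α _ ↦ ?_
    rw [← Finset.mul_sum, ← Finset.mul_sum]
    by_cases hα : S α
    · rw [hform α (outerHeight_simple_of_mem hα), mul_zero, mul_zero]
    · rw [hφ α hα, hγ α hα]
  have hγle : ∑ θ ∈ W, intForm θ γ ≤ 0 := by
    have : 2 * ∑ φ ∈ W, intForm φ γ ≤ 0 := by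
      rw [Finset.mul_sum]
      refine Finset.sum_nonpos fun φ hφ ↦ ?_
      rw [two_mul_intForm]
      exact mul_nonpos_of_nonpos_of_nonneg (hle φ ((hW φ).1 hφ)) (intForm_self_nonneg γ)
    lia
  have hsum : ∑ φ ∈ W, (rootSystem H).root φ = 0 := by
    apply sum_root_eq_zero_of_intForm
    rw [Finset.sum_comm]
    refine Finset.sum_nonpos fun φ hφ ↦ ?_
    rw [hconst φ (hsame φ ((hW φ).1 hφ))]
    exact hγle
  -- The vanishing sum has coefficient `|V| * n_α(φ₀)` at each `α` outside `S`.
  refine h0 (outerHeight_eq_zero_of_simpleCoeff fun α hα ↦ ?_)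
  have h1 := LinearMap.congr_fun hsum (fundCoweight b α)
  rw [LinearMap.sum_apply, LinearMap.zero_apply] at h1
  simp only [root_apply_fundCoweight] at h1
  have h2 : ∑ φ ∈ W, simpleCoeff b φ α = 0 := by exact_mod_cast h1
  rw [Finset.sum_congr rfl fun φ hφ ↦ hsame φ ((hW φ).1 hφ) α hα, Finset.sum_const] at h2
  have h3 : W.card ≠ 0 := Finset.card_ne_zero_of_mem ((hW φ₀).2 hφ₀)
  simpa [h3] using h2

end OuterHeight

/-! ### Roots of the parabolic, its nilradical, its Levi factor, and restriction to the center -/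

section Parabolic

variable {L : Type*} [LieRing L] [LieAlgebra ℂ L] [FiniteDimensional ℂ L] [IsKilling ℂ L]
variable {H : LieSubalgebra ℂ L} [H.IsCartanSubalgebra]

open IsKilling RootPairing

/-- The simple roots whose negatives are roots of `q`. -/
def leviSimple (b : (rootSystem H).Base) (q : LieSubalgebra ℂ L) (α : b.support) : Prop :=
  ∀ γ : H.root, (rootSystem H).root γ = -(rootSystem H).root α → rootSub γ ≤ q.toSubmodule

variable {b : (rootSystem H).Base} {q : LieSubalgebra ℂ L}

lemma cartan_le_of_borel_le (hbq : borel b ≤ q.toSubmodule) : H.toSubmodule ≤ q.toSubmodule :=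
  le_sup_left.trans hbq

lemma rootSub_le_of_borel_le (hbq : borel b ≤ q.toSubmodule) {φ : H.root} (hφ : b.IsPos φ) :
    rootSub φ ≤ q.toSubmodule :=
  (le_iSup₂_of_le (f := fun (φ : H.root) (_ : b.IsPos φ) ↦ rootSub φ) φ hφ le_rfl).trans
    (le_sup_right.trans hbq)

lemma rootSub_add_le {φ γ η : H.root}
    (h : (rootSystem H).root η = (rootSystem H).root φ + (rootSystem H).root γ)
    (hφ : rootSub φ ≤ q.toSubmodule) (hγ : rootSub γ ≤ q.toSubmodule) :
    rootSub η ≤ q.toSubmodule :=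
  rootSub_le_of_lie h fun _ hx _ hy ↦ q.lie_mem (hφ hx) (hγ hy)

lemma leviSimple_iff_outerHeight {α : b.support} :
    leviSimple b q α ↔ outerHeight b (leviSimple b q) α = 0 := by
  refine ⟨outerHeight_simple_of_mem, fun h ↦ ?_⟩
  by_contra hn
  rw [outerHeight_simple_of_notMem hn] at h
  exact one_ne_zero h

/-- Induction on `k = i + j` with `j` simple. If `-k` is a root of `q`, so are `-i = -k + j` and `-j
= -k + i`, because `q` contains the positive root spaces; the converse adds `-i` and `-j`. -/
lemma neg_rootSub_le_iff (hbq : borel b ≤ q.toSubmodule) {φ : H.root} (hφ : b.IsPos φ) :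
    (∀ γ : H.root, (rootSystem H).root γ = -(rootSystem H).root φ → rootSub γ ≤ q.toSubmodule) ↔
      outerHeight b (leviSimple b q) φ = 0 := by
  suffices b.IsPos φ ∧ ((∀ γ : H.root, (rootSystem H).root γ = -(rootSystem H).root φ →
      rootSub γ ≤ q.toSubmodule) ↔ outerHeight b (leviSimple b q) φ = 0) from this.2
  refine Base.IsPos.induction_on_add (p := fun φ ↦ b.IsPos φ ∧
    ((∀ γ : H.root, (rootSystem H).root γ = -(rootSystem H).root φ →
      rootSub γ ≤ q.toSubmodule) ↔ outerHeight b (leviSimple b q) φ = 0)) hφ ?_ ?_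
  · exact fun i hi ↦ ⟨isPos_simple b ⟨i, hi⟩, leviSimple_iff_outerHeight (α := ⟨i, hi⟩)⟩
  · rintro i j k hk ⟨hi, hi'⟩ hj
    have hjp := isPos_simple b ⟨j, hj⟩
    have hj' := leviSimple_iff_outerHeight (q := q) (α := ⟨j, hj⟩)
    refine ⟨hi.add hjp hk, ?_⟩
    have hi0 := outerHeight_nonneg (S := leviSimple b q) hi
    have hj0 := outerHeight_nonneg (S := leviSimple b q) hjp
    have hsum : outerHeight b (leviSimple b q) k = 0 ↔
        outerHeight b (leviSimple b q) i = 0 ∧ outerHeight b (leviSimple b q) j = 0 := by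
      rw [outerHeight_add hk]
      simp only at hj0
      lia
    rw [hsum, ← hi', ← hj']
    constructor
    · intro h
      obtain ⟨κ, hκ⟩ := exists_root_eq_neg k
      exact ⟨fun γ hγ ↦ rootSub_add_le (by rw [hγ, hκ, hk]; abel) (h κ hκ)
          (rootSub_le_of_borel_le hbq hjp),
        fun γ hγ ↦ rootSub_add_le (by rw [hγ, hκ, hk]; abel) (h κ hκ)
          (rootSub_le_of_borel_le hbq hi)⟩
    · rintro ⟨h1, h2⟩ γ hγ
      obtain ⟨ι, hι⟩ := exists_root_eq_neg i
      obtain ⟨κ, hκ⟩ := exists_root_eq_neg j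
      exact rootSub_add_le (by rw [hγ, hι, hκ, hk]; abel) (h1 ι hι) (h2 κ hκ)

/-- The roots of a standard parabolic subalgebra. -/
lemma rootSub_le_iff (hbq : borel b ≤ q.toSubmodule) {φ : H.root} :
    rootSub φ ≤ q.toSubmodule ↔ 0 ≤ outerHeight b (leviSimple b q) φ := by
  by_cases hφ : b.IsPos φ
  · exact iff_of_true (rootSub_le_of_borel_le hbq hφ) (outerHeight_nonneg hφ)
  · obtain ⟨γ, hγ⟩ := exists_root_eq_neg φ
    have hγp : b.IsPos γ := isPos_iff_simpleCoeff_nonneg.2 fun α ↦ by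
      rw [simpleCoeff_of_neg hγ]
      have := simpleCoeff_nonpos_of_not_isPos hφ α
      lia
    have h1 := neg_rootSub_le_iff hbq hγp
    rw [outerHeight_of_neg hγ] at h1
    have h2 := outerHeight_nonpos (S := leviSimple b q) hφ
    have h3 : 0 ≤ outerHeight b (leviSimple b q) φ ↔
      -outerHeight b (leviSimple b q) φ = 0 := by lia
    rw [h3, ← h1]
    refine ⟨fun h δ hδ ↦ ?_, fun h ↦ h φ (by rw [hγ, neg_neg])⟩
    have : δ = φ := (rootSystem H).root.injective (by rw [hδ, hγ, neg_neg])
    rwa [this]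

lemma parabolic_eq (hbq : borel b ≤ q.toSubmodule) :
    q.toSubmodule = H.toSubmodule ⊔ rootSum {φ | 0 ≤ outerHeight b (leviSimple b q) φ} := by
  have hH := cartan_le_of_borel_le hbq
  rw [eq_cartan_sup_rootSum (W := q.toSubmodule) (fun h hh x hx ↦ q.lie_mem (hH hh) hx) hH]
  simp only [rootSub_le_iff hbq]

/-! ### The nilradical -/

lemma exists_outerHeight_lt (b : (rootSystem H).Base) (S : b.support → Prop) :
    ∃ N : ℕ, ∀ φ, outerHeight b S φ < N := by
  obtain ⟨M, hM⟩ := (Set.finite_range (outerHeight b S)).bddAbove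
  refine ⟨(M + 1).toNat, fun φ ↦ ?_⟩
  have := hM ⟨φ, rfl⟩
  lia

/-- The sum of the root spaces of positive outer height, as an ideal of `q`. -/
def outerIdeal (b : (rootSystem H).Base) (q : LieSubalgebra ℂ L)
    (hbq : borel b ≤ q.toSubmodule) : LieIdeal ℂ q where
  __ := (rootSum {φ | 0 < outerHeight b (leviSimple b q) φ}).comap q.toSubmodule.subtype
  lie_mem := by
    intro x y hy
    have hx : (x : L) ∈ H.toSubmodule ⊔ rootSum {φ | 0 ≤ outerHeight b (leviSimple b q) φ} := by
      rw [← parabolic_eq hbq]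
      exact x.2
    change (y : L) ∈ rootSum {φ | 0 < outerHeight b (leviSimple b q) φ} at hy
    change ⁅(x : L), (y : L)⁆ ∈ rootSum {φ | 0 < outerHeight b (leviSimple b q) φ}
    obtain ⟨h, hh, z, hz, hhz⟩ := Submodule.mem_sup.1 hx
    rw [← hhz, add_lie]
    refine add_mem (lie_mem_rootSum_of_mem_cartan hh hy) (lie_mem_rootSum ?_ ?_ hz hy)
    · intro φ hφ γ hγ
      exact add_ne_zero_of_outerHeight (b := b) (S := leviSimple b q)
        (add_pos_of_nonneg_of_pos hφ hγ).ne'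
    · intro φ hφ γ hγ η hη
      simp only [Set.mem_ofPred_eq] at hφ hγ ⊢
      rw [outerHeight_add hη]
      exact add_pos_of_nonneg_of_pos hφ hγ

lemma mem_outerIdeal {hbq : borel b ≤ q.toSubmodule} {x : q} :
    x ∈ outerIdeal b q hbq ↔
      (x : L) ∈ rootSum {φ | 0 < outerHeight b (leviSimple b q) φ} := Iff.rfl

lemma rootSum_empty : rootSum (∅ : Set H.root) = ⊥ := by simp [rootSum]

/-- By Engel it suffices that each `ad x` is nilpotent, and `ad x` raises outer height, which is
bounded. -/
lemma isNilpotent_outerIdeal (hbq : borel b ≤ q.toSubmodule) :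
    LieRing.IsNilpotent (outerIdeal b q hbq) := by
  rw [LieAlgebra.isNilpotent_iff_forall (R := ℂ)]
  intro x
  obtain ⟨N, hN⟩ := exists_outerHeight_lt b (leviSimple b q)
  have key : ∀ (n : ℕ) (y : outerIdeal b q hbq),
      ((((ad ℂ (outerIdeal b q hbq) x) ^ n) y : q) : L) ∈
        rootSum {φ | (n : ℤ) < outerHeight b (leviSimple b q) φ} := by
    intro n y
    induction n with
    | zero => exact mem_outerIdeal.1 y.2
    | succ n ih =>
      rw [pow_succ', Module.End.mul_apply]
      change ⁅((x : q) : L), ((((ad ℂ (outerIdeal b q hbq) x) ^ n) y : q) : L)⁆ ∈ _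
      have hx := mem_outerIdeal.1 x.2
      refine lie_mem_rootSum ?_ ?_ hx ih
      · intro φ hφ γ hγ
        simp only [Set.mem_ofPred_eq] at hφ hγ
        exact add_ne_zero_of_outerHeight (b := b) (S := leviSimple b q) (by lia)
      · intro φ hφ γ hγ η hη
        simp only [Set.mem_ofPred_eq] at hφ hγ ⊢
        rw [outerHeight_add hη]
        push_cast
        lia
  refine ⟨N, LinearMap.ext fun y ↦ ?_⟩
  have h := key N y
  have he : {φ | (N : ℤ) < outerHeight b (leviSimple b q) φ} = ∅ := by
    ext φ
    have := hN φ
    simp only [Set.mem_ofPred_eq, Set.mem_empty_iff_false, iff_false]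
    lia
  rw [he, rootSum_empty, Submodule.mem_bot] at h
  exact Subtype.ext (Subtype.ext h)

lemma exists_isPos_root_apply_ne_zero (b : (rootSystem H).Base) {h : H} (hh : h ≠ 0) :
    ∃ φ, b.IsPos φ ∧ (rootSystem H).root φ h ≠ 0 := by
  by_contra! hcon
  apply hh
  have h1 : Module.Dual.eval ℂ H h = 0 := by
    refine b.toWeightBasis.ext fun α ↦ ?_
    rw [Base.toWeightBasis_apply]
    exact hcon α (isPos_simple b α)
  exact (Module.evalEquiv ℂ H).injective (by rw [map_zero]; exact h1)

/-- If `h ≠ 0` lies in both, some positive root `φ` has `φ(h) ≠ 0`. Then the root space of `φ` lies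
in `I`, and `ad h` has a nonzero eigenvalue on `I`. -/
lemma inf_cartan_eq_bot_of_isNilpotent (hbq : borel b ≤ q.toSubmodule) {I : LieIdeal ℂ q}
    (hI : LieRing.IsNilpotent I) : ambient q I ⊓ H.toSubmodule = ⊥ := by
  rw [Submodule.eq_bot_iff]
  rintro h ⟨⟨(h' : q), hI', rfl⟩, hH⟩
  by_contra hne
  obtain ⟨φ, hφ, hφh⟩ := exists_isPos_root_apply_ne_zero b (h := ⟨h', hH⟩)
    (fun h0 ↦ hne (congrArg Subtype.val h0))
  obtain ⟨e, he, he0⟩ := exists_ne_zero_mem_rootSub φ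
  set c := (rootSystem H).root φ ⟨h', hH⟩
  have hc : ⁅(h' : L), e⁆ = c • e := mem_rootSub_iff.1 he ⟨h', hH⟩
  let e' : q := ⟨e, rootSub_le_of_borel_le hbq hφ he⟩
  have hc' : ⁅h', e'⁆ = c • e' := Subtype.ext hc
  have heI : e' ∈ I := by
    have h1 : c • e' ∈ I := by
      rw [← hc', ← lie_skew]
      exact neg_mem (I.lie_mem hI')
    rw [← inv_smul_smul₀ hφh e']
    exact I.smul_mem _ h1
  obtain ⟨k, hk⟩ := (LieAlgebra.isNilpotent_iff_forall (R := ℂ)).1 hI ⟨h', hI'⟩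
  have hpow : ∀ n : ℕ, ((ad ℂ I ⟨h', hI'⟩) ^ n) ⟨e', heI⟩ = c ^ n • (⟨e', heI⟩ : I) := by
    intro n
    induction n with
    | zero => simp
    | succ n ih =>
      rw [pow_succ', Module.End.mul_apply, ih, map_smul, pow_succ, mul_smul]
      congr 1
      exact Subtype.ext hc'
  have h2 := hpow k
  rw [hk, LinearMap.zero_apply, eq_comm, smul_eq_zero_iff_right (pow_ne_zero k hφh)] at h2
  exact he0 (congrArg (fun z : I ↦ ((z : q) : L)) h2)

/-- Meeting the Cartan subalgebra trivially, `I` is a sum of root spaces. A root `φ` of outer height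
zero cannot occur: `-φ` is also a root of `q`, and bracketing the two would put a nonzero Cartan
element in `I`. -/
lemma le_outerIdeal_of_isNilpotent (hbq : borel b ≤ q.toSubmodule) {I : LieIdeal ℂ q}
    (hI : LieRing.IsNilpotent I) : I ≤ outerIdeal b q hbq := by
  have hH := cartan_le_of_borel_le hbq
  have hst : ∀ h ∈ H, ∀ x ∈ ambient q I, ⁅h, x⁆ ∈ ambient q I := by
    rintro h hh _ ⟨x, hx, rfl⟩
    exact ⟨⁅(⟨h, hH hh⟩ : q), x⁆, I.lie_mem hx, rfl⟩
  have hbot := inf_cartan_eq_bot_of_isNilpotent hbq hI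
  have heq := eq_rootSum_of_inf_cartan hst hbot
  intro x hx
  rw [mem_outerIdeal]
  have hx' : (x : L) ∈ ambient q I := ⟨x, hx, rfl⟩
  rw [heq] at hx'
  refine rootSum_mono (fun φ hφ ↦ ?_) hx'
  simp only [Set.mem_ofPred_eq] at hφ ⊢
  have hIq : ambient q I ≤ q.toSubmodule := by
    rintro _ ⟨y, -, rfl⟩
    exact y.2
  have h0 := (rootSub_le_iff hbq).1 (hφ.trans hIq)
  refine lt_of_le_of_ne h0 fun h1 ↦ ?_
  obtain ⟨γ, hγ⟩ := exists_root_eq_neg φ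
  have hγq : rootSub γ ≤ q.toSubmodule := by
    rw [rootSub_le_iff hbq, outerHeight_of_neg hγ, ← h1, neg_zero]
  obtain ⟨e, he, f, hf, hef, hne⟩ := exists_lie_ne_zero_mem_cartan hγ
  obtain ⟨y, hy, hye⟩ := hφ he
  have hmem : ⁅e, f⁆ ∈ ambient q I := by
    rw [← lie_skew]
    refine neg_mem ⟨⁅(⟨f, hγq hf⟩ : q), y⁆, I.lie_mem hy, ?_⟩
    rw [← hye]
    rfl
  have : ⁅e, f⁆ ∈ ambient q I ⊓ H.toSubmodule := ⟨hmem, hef⟩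
  rw [hbot] at this
  exact hne this

/-- The nilradical of a standard parabolic subalgebra. -/
lemma nilradical_eq (hbq : borel b ≤ q.toSubmodule) :
    (nilradical q).toSubmodule = rootSum {φ | 0 < outerHeight b (leviSimple b q) φ} := by
  have h1 : sSup {I : LieIdeal ℂ q | LieRing.IsNilpotent I} = outerIdeal b q hbq :=
    le_antisymm (sSup_le fun I hI ↦ le_outerIdeal_of_isNilpotent hbq hI)
      (le_sSup (isNilpotent_outerIdeal hbq))
  ext x
  constructor
  · rintro ⟨y, hy, rfl⟩
    rw [h1] at hy
    exact hy
  · intro hx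
    have hxq : x ∈ q := by
      have h2 : rootSum {φ | 0 < outerHeight b (leviSimple b q) φ} ≤ q.toSubmodule :=
        rootSum_le_iff.2 fun φ hφ ↦ (rootSub_le_iff hbq).2 (le_of_lt hφ)
      exact h2 hx
    refine ⟨⟨x, hxq⟩, ?_, rfl⟩
    rw [h1]
    exact hx

/-! ### The Levi factor and its center -/

variable {m : LieSubalgebra ℂ L}

lemma rootSum_union (Φ Ψ : Set H.root) : rootSum (Φ ∪ Ψ) = rootSum Φ ⊔ rootSum Ψ :=
  iSup_union

lemma IsLeviFactor.rootSub_le_iff (hm : IsLeviFactor q m) (hbq : borel b ≤ q.toSubmodule)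
    (hHm : H ≤ m) {φ : H.root} :
    rootSub φ ≤ m.toSubmodule ↔ outerHeight b (leviSimple b q) φ = 0 := by
  have hmq : m.toSubmodule ≤ q.toSubmodule := hm.sup_eq ▸ le_sup_left
  constructor
  · intro h
    have h0 := (LeviRoots.rootSub_le_iff hbq).1 (h.trans hmq)
    refine (lt_or_eq_of_le h0).elim (fun h1 ↦ ?_) Eq.symm
    have h2 : rootSub φ ≤ (nilradical q).toSubmodule := by
      rw [nilradical_eq hbq]
      exact rootSub_le_rootSum h1
    exact absurd (disjoint_self.1 (hm.disjoint.mono h h2)) (rootSub_ne_bot φ)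
  · intro h
    have h1 : rootSub φ ≤ q.toSubmodule := (LeviRoots.rootSub_le_iff hbq).2 h.ge
    have hst : ∀ h ∈ H, ∀ x ∈ m.toSubmodule, ⁅h, x⁆ ∈ m.toSubmodule :=
      fun h hh x hx ↦ m.lie_mem (hHm hh) hx
    rw [← hm.sup_eq, nilradical_eq hbq, eq_cartan_sup_rootSum hst hHm, sup_assoc,
      ← rootSum_union, rootSub_le_cartan_sup_iff] at h1
    rcases h1 with h1 | h1
    · exact h1
    · exact absurd h (ne_of_gt h1)

lemma IsLeviFactor.eq (hm : IsLeviFactor q m) (hbq : borel b ≤ q.toSubmodule) (hHm : H ≤ m) :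
    m.toSubmodule = H.toSubmodule ⊔ rootSum {φ | outerHeight b (leviSimple b q) φ = 0} := by
  rw [eq_cartan_sup_rootSum (W := m.toSubmodule) (fun h hh x hx ↦ m.lie_mem (hHm hh) hx) hHm]
  simp only [hm.rootSub_le_iff hbq hHm]

lemma ambient_le {k : LieSubalgebra ℂ L} (I : LieIdeal ℂ k) : ambient k I ≤ k.toSubmodule := by
  rintro _ ⟨y, -, rfl⟩
  exact y.2

/-- A root vector `e` in `m` is half of `⁅t, e⁆`, with `t` the coroot in `H ≤ m`, so it already lies
in `[m, m]`. -/
lemma IsLeviFactor.isLeviSimple_iff (hm : IsLeviFactor q m) (hbq : borel b ≤ q.toSubmodule)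
    (hHm : H ≤ m) {α : b.support} : IsLeviSimple b m α ↔ leviSimple b q α := by
  rw [leviSimple_iff_outerHeight, ← hm.rootSub_le_iff hbq hHm]
  refine ⟨fun h ↦ le_trans h (ambient_le _), fun h ↦ ?_⟩
  obtain ⟨e, he, he0⟩ := exists_ne_zero_mem_rootSub (α : H.root)
  refine rootSub_le_of_mem he he0 ?_
  set t : H := coroot (α : H.root)
  have h2 : ⁅(t : L), e⁆ = (2 : ℂ) • e := by
    rw [mem_rootSub_iff.1 he t]
    congr 1
    exact root_apply_coroot (H.isNonZero_coe_root (α : H.root))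
  refine ⟨⁅(⟨t, hHm t.2⟩ : m), (2⁻¹ : ℂ) • (⟨e, h he⟩ : m)⁆, ?_, ?_⟩
  · exact LieSubmodule.lie_mem_lie (LieSubmodule.mem_top _) (LieSubmodule.mem_top _)
  · change ⁅(t : L), (2⁻¹ : ℂ) • e⁆ = e
    rw [lie_smul, h2, smul_smul]
    norm_num

lemma IsLeviFactor.root_apply_centIncl (hm : IsLeviFactor q m) (hbq : borel b ≤ q.toSubmodule)
    (hHm : H ≤ m) {φ : H.root} (hφ : outerHeight b (leviSimple b q) φ = 0) (x : Cent m) :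
    (rootSystem H).root φ (centIncl hHm x) = 0 := by
  obtain ⟨e, he, he0⟩ := exists_ne_zero_mem_rootSub φ
  have h1 := mem_rootSub_iff.1 he (centIncl hHm x)
  have h2 : ⁅(⟨e, (hm.rootSub_le_iff hbq hHm).2 hφ he⟩ : m), (x : m)⁆ = 0 := x.2 _
  have h3 : ⁅e, ((x : m) : L)⁆ = 0 := congrArg (fun z : m ↦ (z : L)) h2
  have h4 : ⁅((centIncl hHm x : H) : L), e⁆ = 0 := by
    change ⁅((x : m) : L), e⁆ = 0
    rw [← lie_skew, h3, neg_zero]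
  rw [h4, eq_comm] at h1
  exact (smul_eq_zero.1 h1).resolve_right he0

lemma lie_eq_zero_of_mem_cartan {x y : L} (hx : x ∈ H) (hy : y ∈ H) : ⁅x, y⁆ = 0 :=
  congrArg (fun z : H ↦ (z : L)) (trivial_lie_zero H H ⟨x, hx⟩ ⟨y, hy⟩)

/-- `m` is `H` plus the root spaces of outer height zero, and `h` commutes with all of these. The
lemma serves to place in `𝔱` the fundamental coweights of the simple roots outside `S`. -/
lemma IsLeviFactor.exists_centIncl_eq (hm : IsLeviFactor q m) (hbq : borel b ≤ q.toSubmodule)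
    (hHm : H ≤ m) {h : H}
    (hh : ∀ φ, outerHeight b (leviSimple b q) φ = 0 → (rootSystem H).root φ h = 0) :
    ∃ x : Cent m, centIncl hHm x = h := by
  refine ⟨⟨⟨h, hHm h.2⟩, fun y ↦ ?_⟩, rfl⟩
  apply Subtype.ext
  change ⁅(y : L), (h : L)⁆ = 0
  have hy : (y : L) ∈ H.toSubmodule ⊔
      rootSum {φ | outerHeight b (leviSimple b q) φ = 0} := by
    rw [← hm.eq hbq hHm]
    exact y.2
  obtain ⟨t, ht, z, hz, htz⟩ := Submodule.mem_sup.1 hy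
  rw [← htz, add_lie, lie_eq_zero_of_mem_cartan ht h.2, zero_add]
  refine rootSum_induction (p := fun z ↦ ⁅z, (h : L)⁆ = 0) ?_ (zero_lie _) ?_ hz
  · intro φ hφ z hz
    rw [← lie_skew, mem_rootSub_iff.1 hz h, hh φ hφ, zero_smul, neg_zero]
  · intro x y hx hy
    rw [add_lie, hx, hy, add_zero]

lemma resT_add (hHm : H ≤ m) {φ γ η : H.root}
    (h : (rootSystem H).root η = (rootSystem H).root φ + (rootSystem H).root γ) :
    resT hHm η = resT hHm φ + resT hHm γ := by
  rw [resT, h, LinearMap.add_comp]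
  rfl

lemma IsLeviFactor.resT_eq_iff (hm : IsLeviFactor q m) (hbq : borel b ≤ q.toSubmodule)
    (hHm : H ≤ m) {φ γ : H.root} :
    resT hHm φ = resT hHm γ ↔ SameOuter b (leviSimple b q) φ γ := by
  constructor
  · intro h α hα
    obtain ⟨x, hx⟩ := hm.exists_centIncl_eq hbq hHm (h := fundCoweight b α) fun φ hφ ↦ by
      rw [root_apply_fundCoweight, simpleCoeff_eq_zero_of_outerHeight_eq_zero hφ hα, Int.cast_zero]
    have h1 := LinearMap.congr_fun h x
    simp only [resT, LinearMap.comp_apply, hx, root_apply_fundCoweight] at h1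
    exact_mod_cast h1
  · intro h
    ext x
    simp only [resT, LinearMap.comp_apply]
    rw [root_eq_sum_simpleCoeff b φ, root_eq_sum_simpleCoeff b γ, LinearMap.sum_apply,
      LinearMap.sum_apply]
    refine Finset.sum_congr rfl fun α _ ↦ ?_
    rw [LinearMap.smul_apply, LinearMap.smul_apply]
    by_cases hα : leviSimple b q α
    · rw [hm.root_apply_centIncl hbq hHm (outerHeight_simple_of_mem hα), smul_zero, smul_zero]
    · rw [h α hα]

lemma IsLeviFactor.outerHeight_eq_add_of_resT (hm : IsLeviFactor q m)
    (hbq : borel b ≤ q.toSubmodule) (hHm : H ≤ m) {φ γ η : H.root}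
    (h : resT hHm η = resT hHm φ + resT hHm γ) :
    outerHeight b (leviSimple b q) η =
      outerHeight b (leviSimple b q) φ + outerHeight b (leviSimple b q) γ := by
  classical
  rw [outerHeight, outerHeight, outerHeight, ← Finset.sum_add_distrib]
  refine Finset.sum_congr rfl fun α hα ↦ ?_
  replace hα := (Finset.mem_filter.1 hα).2
  obtain ⟨x, hx⟩ := hm.exists_centIncl_eq hbq hHm (h := fundCoweight b α) fun φ hφ ↦ by
    rw [root_apply_fundCoweight, simpleCoeff_eq_zero_of_outerHeight_eq_zero hφ hα, Int.cast_zero]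
  have h1 := LinearMap.congr_fun h x
  simp only [resT, LinearMap.add_apply, LinearMap.comp_apply, hx, root_apply_fundCoweight] at h1
  exact_mod_cast h1

lemma IsLeviFactor.resT_eq_zero_iff (hm : IsLeviFactor q m) (hbq : borel b ≤ q.toSubmodule)
    (hHm : H ≤ m) {φ : H.root} :
    resT hHm φ = 0 ↔ outerHeight b (leviSimple b q) φ = 0 := by
  constructor
  · intro h
    obtain ⟨γ, hγ⟩ := exists_root_eq_neg φ
    -- Both restrictions vanish, so `φ` and `-φ` lie in one fiber and have equal, yet opposite,
    -- outer heights.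
    have h1 : resT hHm φ = resT hHm γ := by
      have : resT hHm γ = -resT hHm φ := by
        rw [resT, hγ, LinearMap.neg_comp]
        rfl
      rw [this, h, neg_zero]
    have h2 := ((hm.resT_eq_iff hbq hHm).1 h1).outerHeight_eq
    rw [outerHeight_of_neg hγ] at h2
    lia
  · intro h
    ext x
    exact hm.root_apply_centIncl hbq hHm h x

end Parabolic

/-! ### Root spaces of the center, their brackets, and the upper central series -/

section TRoots

variable {L : Type*} [LieRing L] [LieAlgebra ℂ L] [FiniteDimensional ℂ L] [IsKilling ℂ L]
variable {H : LieSubalgebra ℂ L} [H.IsCartanSubalgebra]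

open IsKilling RootPairing

variable {b : (rootSystem H).Base} {q m : LieSubalgebra ℂ L}

lemma mem_tRootSpace {ν : Module.Dual ℂ (Cent m)} {z : L} :
    z ∈ tRootSpace m ν ↔ ∀ x : Cent m, ⁅((x : m) : L), z⁆ = ν x • z := Iff.rfl

lemma rootSub_le_tRootSpace_iff (hHm : H ≤ m) {φ : H.root} {ν : Module.Dual ℂ (Cent m)} :
    rootSub φ ≤ tRootSpace m ν ↔ resT hHm φ = ν := by
  constructor
  · intro h
    obtain ⟨e, he, he0⟩ := exists_ne_zero_mem_rootSub φ
    ext x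
    have h1 := mem_rootSub_iff.1 he (centIncl hHm x)
    have h2 := mem_tRootSpace.1 (h he) x
    exact smul_left_injective ℂ he0 (h1.symm.trans h2)
  · rintro rfl e he x
    exact mem_rootSub_iff.1 he (centIncl hHm x)

/-- `𝔱` commutes with `H`, so for `ν ≠ 0` the space is stable under `H` and meets it trivially. -/
lemma tRootSpace_eq (hHm : H ≤ m) {ν : Module.Dual ℂ (Cent m)} (hν : ν ≠ 0) :
    tRootSpace m ν = rootSum {φ : H.root | resT hHm φ = ν} := by
  have h1 : ∀ h ∈ H, ∀ z ∈ tRootSpace m ν, ⁅h, z⁆ ∈ tRootSpace m ν := by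
    intro h hh z hz x
    rw [leibniz_lie, lie_eq_zero_of_mem_cartan (coe_cent_mem hHm x) hh, zero_lie, zero_add,
      mem_tRootSpace.1 hz x, lie_smul]
  have h2 : tRootSpace m ν ⊓ H.toSubmodule = ⊥ := by
    rw [Submodule.eq_bot_iff]
    rintro z ⟨hz, hzH⟩
    obtain ⟨x, hx⟩ : ∃ x, ν x ≠ 0 := by
      by_contra! h
      exact hν (LinearMap.ext h)
    have h3 := mem_tRootSpace.1 hz x
    rw [lie_eq_zero_of_mem_cartan (coe_cent_mem hHm x) hzH, eq_comm] at h3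
    exact (smul_eq_zero.1 h3).resolve_left hx
  rw [eq_rootSum_of_inf_cartan h1 h2]
  simp only [rootSub_le_tRootSpace_iff hHm]

lemma IsLeviFactor.tRootSpace_resT (hm : IsLeviFactor q m) (hbq : borel b ≤ q.toSubmodule)
    (hHm : H ≤ m) {φ : H.root} (hφ : outerHeight b (leviSimple b q) φ ≠ 0) :
    tRootSpace m (resT hHm φ) = rootSum {γ | SameOuter b (leviSimple b q) γ φ} := by
  rw [tRootSpace_eq hHm (fun h ↦ hφ ((hm.resT_eq_zero_iff hbq hHm).1 h))]
  simp only [hm.resT_eq_iff hbq hHm]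

lemma IsLeviFactor.isTRoot_iff (hm : IsLeviFactor q m) (hbq : borel b ≤ q.toSubmodule)
    (hHm : H ≤ m) {ν : Module.Dual ℂ (Cent m)} :
    IsTRoot m ν ↔ ∃ φ : H.root, outerHeight b (leviSimple b q) φ ≠ 0 ∧ resT hHm φ = ν := by
  constructor
  · rintro ⟨h0, h1⟩
    rw [tRootSpace_eq hHm h0] at h1
    obtain ⟨φ, hφ⟩ : {φ : H.root | resT hHm φ = ν}.Nonempty := by
      by_contra h
      rw [Set.not_nonempty_iff_eq_empty.1 h, rootSum_empty] at h1
      exact h1 rfl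
    exact ⟨φ, fun h ↦ h0 (by rw [← hφ, (hm.resT_eq_zero_iff hbq hHm).2 h]), hφ⟩
  · rintro ⟨φ, hφ, rfl⟩
    refine ⟨fun h ↦ hφ ((hm.resT_eq_zero_iff hbq hHm).1 h), fun h ↦ ?_⟩
    have := (rootSub_le_tRootSpace_iff hHm).2 (rfl : resT hHm φ = _)
    rw [h, le_bot_iff] at this
    exact rootSub_ne_bot φ this

lemma IsLeviFactor.isTRoot_resT (hm : IsLeviFactor q m) (hbq : borel b ≤ q.toSubmodule)
    (hHm : H ≤ m) {φ : H.root} (hφ : outerHeight b (leviSimple b q) φ ≠ 0) :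
    IsTRoot m (resT hHm φ) :=
  (hm.isTRoot_iff hbq hHm).2 ⟨φ, hφ, rfl⟩

lemma IsLeviFactor.order_resT (hm : IsLeviFactor q m) (hbq : borel b ≤ q.toSubmodule)
    (hHm : H ≤ m) (φ : H.root) :
    order b m (resT hHm φ) = outerHeight b (leviSimple b q) φ := by
  classical
  have hex : ∃ γ : H.root, (rootSpace H (γ : Weight ℂ H L)).toSubmodule ≤
      tRootSpace m (resT hHm φ) := ⟨φ, (rootSub_le_tRootSpace_iff hHm).2 rfl⟩
  have h1 : SameOuter b (leviSimple b q) hex.choose φ :=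
    (hm.resT_eq_iff hbq hHm).1 ((rootSub_le_tRootSpace_iff hHm).1 hex.choose_spec)
  rw [← h1.outerHeight_eq, order, outerHeight]
  refine Finset.sum_congr (Finset.filter_congr fun α _ ↦ ?_) fun α _ ↦ ?_
  · rw [hm.isLeviSimple_iff hbq hHm]
  · rw [tCoeff, dif_pos hex]

lemma IsLeviFactor.isPosTRoot_iff (hm : IsLeviFactor q m) (hbq : borel b ≤ q.toSubmodule)
    (hHm : H ≤ m) {ν : Module.Dual ℂ (Cent m)} :
    IsPosTRoot q m ν ↔ ∃ φ : H.root, 0 < outerHeight b (leviSimple b q) φ ∧ resT hHm φ = ν := by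
  constructor
  · rintro ⟨h0, h1⟩
    obtain ⟨φ, hφ, rfl⟩ := (hm.isTRoot_iff hbq hHm).1 h0
    refine ⟨φ, ?_, rfl⟩
    have h2 := ((rootSub_le_tRootSpace_iff hHm).2 (rfl : resT hHm φ = _)).trans h1
    rw [nilradical_eq hbq] at h2
    exact rootSub_le_rootSum_iff.1 h2
  · rintro ⟨φ, hφ, rfl⟩
    refine ⟨hm.isTRoot_resT hbq hHm hφ.ne', ?_⟩
    rw [hm.tRootSpace_resT hbq hHm hφ.ne', nilradical_eq hbq]
    refine rootSum_mono fun γ hγ ↦ ?_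
    simp only [Set.mem_ofPred_eq] at hγ ⊢
    rwa [hγ.outerHeight_eq]

lemma IsLeviFactor.layer_le (hm : IsLeviFactor q m) (hbq : borel b ≤ q.toSubmodule)
    (hHm : H ≤ m) (k : ℤ) :
    layer b m k ≤ rootSum {φ | outerHeight b (leviSimple b q) φ = k} := by
  refine iSup₂_le ?_
  rintro ν ⟨hν, hk⟩
  obtain ⟨φ, hφ, rfl⟩ := (hm.isTRoot_iff hbq hHm).1 hν
  rw [hm.order_resT hbq hHm] at hk
  rw [hm.tRootSpace_resT hbq hHm hφ]
  refine rootSum_mono fun γ hγ ↦ ?_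
  simp only [Set.mem_ofPred_eq] at hγ ⊢
  rw [hγ.outerHeight_eq, hk]

lemma IsLeviFactor.tRootSpace_le_layer (hm : IsLeviFactor q m) (hbq : borel b ≤ q.toSubmodule)
    (hHm : H ≤ m) {φ : H.root} (hφ : outerHeight b (leviSimple b q) φ ≠ 0) :
    tRootSpace m (resT hHm φ) ≤ layer b m (outerHeight b (leviSimple b q) φ) :=
  le_iSup₂_of_le (f := fun (ν : Module.Dual ℂ (Cent m))
    (_ : IsTRoot m ν ∧ order b m ν = outerHeight b (leviSimple b q) φ) ↦ tRootSpace m ν)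
    (resT hHm φ) ⟨hm.isTRoot_resT hbq hHm hφ, hm.order_resT hbq hHm φ⟩ le_rfl

/-- At `k = 0` only the inclusion `layer_le` is available in general: the roots of `m` restrict to
zero and are not `𝔱`-roots. -/
lemma IsLeviFactor.layer_eq (hm : IsLeviFactor q m) (hbq : borel b ≤ q.toSubmodule)
    (hHm : H ≤ m) {k : ℤ} (hk : k ≠ 0) :
    layer b m k = rootSum {φ | outerHeight b (leviSimple b q) φ = k} := by
  refine le_antisymm (hm.layer_le hbq hHm k) (rootSum_le_iff.2 ?_)
  rintro φ rfl
  exact ((rootSub_le_tRootSpace_iff hHm).2 rfl).trans (hm.tRootSpace_le_layer hbq hHm hk)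

/-- The bracket of two root spaces of the center of a Levi factor, once it is nonzero, is the
whole root space of the sum. -/
lemma IsLeviFactor.bracket_eq (hm : IsLeviFactor q m) (hbq : borel b ≤ q.toSubmodule)
    (hHm : H ≤ m) {φ γ η : H.root}
    (h : (rootSystem H).root η = (rootSystem H).root φ + (rootSystem H).root γ)
    (hφ : outerHeight b (leviSimple b q) φ ≠ 0) (hγ : outerHeight b (leviSimple b q) γ ≠ 0)
    (hη : outerHeight b (leviSimple b q) η ≠ 0) :
    bracket (tRootSpace m (resT hHm φ)) (tRootSpace m (resT hHm γ)) =
      tRootSpace m (resT hHm η) := by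
  apply le_antisymm
  · rw [bracket, Submodule.span_le]
    rintro _ ⟨u, hu, v, hv, rfl⟩ x
    rw [resT_add hHm h, leibniz_lie, mem_tRootSpace.1 hu x, mem_tRootSpace.1 hv x, smul_lie,
      lie_smul, LinearMap.add_apply, add_smul]
  · rw [hm.tRootSpace_resT hbq hHm hη]
    refine rootSum_le_iff.2 fun θ hθ ↦ ?_
    let V : Set H.root := {θ | ∃ φ' γ', SameOuter b (leviSimple b q) φ' φ ∧
      SameOuter b (leviSimple b q) γ' γ ∧
      (rootSystem H).root θ = (rootSystem H).root φ' + (rootSystem H).root γ'}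
    -- `V` consists of the sums of a root in the fiber of `φ` and one in the fiber of `γ`. If such a
    -- sum plus `σ`, of outer height zero, is a root, Jacobi absorbs `σ` into one of the summands
    -- without leaving its fiber. So irreducibility makes `V` the whole fiber of `η`.
    have hmem : θ ∈ V := by
      refine mem_of_sameOuter (S := leviSimple b q) ?_
        (⟨φ, γ, fun _ _ ↦ rfl, fun _ _ ↦ rfl, h⟩ : η ∈ V) hη ?_ hθ
      · rintro ξ ⟨φ', γ', hφ', hγ', hξ⟩ σ hσ τ hτ
        have hadd : ∀ {κ ρ : H.root},
            (rootSystem H).root κ = (rootSystem H).root ρ + (rootSystem H).root σ →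
            SameOuter b (leviSimple b q) κ ρ := fun hκ α hα ↦ by
          rw [simpleCoeff_add hκ, simpleCoeff_eq_zero_of_outerHeight_eq_zero hσ hα, add_zero]
        rcases add_mem_range_or_add_mem_range hξ hτ
          (add_ne_zero_of_outerHeight (b := b) (S := leviSimple b q)
            (by rw [hσ, hγ'.outerHeight_eq, add_zero]; exact hγ))
          (add_ne_zero_of_outerHeight (b := b) (S := leviSimple b q)
            (by rw [hσ, hφ'.outerHeight_eq, add_zero]; exact hφ)) with ⟨κ, hκ⟩ | ⟨κ, hκ⟩
        · refine ⟨φ', κ, hφ', fun α hα ↦ ?_, by rw [hτ, hξ, hκ, add_assoc]⟩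
          rw [hadd hκ α hα, hγ' α hα]
        · refine ⟨κ, γ', fun α hα ↦ ?_, hγ', by rw [hτ, hξ, hκ]; abel⟩
          rw [hadd hκ α hα, hφ' α hα]
      · rintro ξ ⟨φ', γ', hφ', hγ', hξ⟩ α hα
        rw [simpleCoeff_add hξ, simpleCoeff_add h, hφ' α hα, hγ' α hα]
    obtain ⟨φ', γ', hφ', hγ', hθ'⟩ := hmem
    refine rootSub_le_of_lie hθ' fun x hx y hy ↦ Submodule.subset_span ⟨x, ?_, y, ?_, rfl⟩
    · exact (rootSub_le_tRootSpace_iff hHm).2 ((hm.resT_eq_iff hbq hHm).2 hφ') hx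
    · exact (rootSub_le_tRootSpace_iff hHm).2 ((hm.resT_eq_iff hbq hHm).2 hγ') hy

/-! ### The upper central series -/

lemma upperCentral_zero (n : LieSubalgebra ℂ L) : upperCentral n 0 = ⊥ := by
  rw [Submodule.eq_bot_iff]
  rintro _ ⟨y, hy, rfl⟩
  have hy' : y ∈ (⊥ : LieIdeal ℂ n) := hy
  rw [LieSubmodule.mem_bot] at hy'
  rw [hy']
  rfl

lemma mem_upperCentral_succ {n : LieSubalgebra ℂ L} {i : ℕ} {x : L} :
    x ∈ upperCentral n (i + 1) ↔ x ∈ n ∧ ∀ y ∈ n, ⁅y, x⁆ ∈ upperCentral n i := by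
  constructor
  · rintro ⟨z, hz, rfl⟩
    have hz' : z ∈ (⊥ : LieIdeal ℂ n).ucs (i + 1) := hz
    rw [LieSubmodule.ucs_succ, LieSubmodule.mem_normalizer] at hz'
    exact ⟨z.2, fun y hy ↦ ⟨⁅(⟨y, hy⟩ : n), z⁆, hz' ⟨y, hy⟩, rfl⟩⟩
  · rintro ⟨hx, h⟩
    refine ⟨⟨x, hx⟩, ?_, rfl⟩
    change (⟨x, hx⟩ : n) ∈ (⊥ : LieIdeal ℂ n).ucs (i + 1)
    rw [LieSubmodule.ucs_succ, LieSubmodule.mem_normalizer]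
    intro y
    obtain ⟨w, hw, hwy⟩ := h y y.2
    have : w = ⁅y, (⟨x, hx⟩ : n)⁆ := Subtype.ext hwy
    rw [← this]
    exact hw

lemma upperCentral_one (n : LieSubalgebra ℂ L) :
    upperCentral n 1 = ambient n (LieAlgebra.center ℂ n) := by
  ext x
  rw [← zero_add 1, mem_upperCentral_succ, upperCentral_zero]
  constructor
  · rintro ⟨hx, h⟩
    exact ⟨⟨x, hx⟩, fun y ↦ Subtype.ext (h y y.2), rfl⟩
  · rintro ⟨z, hz, rfl⟩
    exact ⟨z.2, fun y hy ↦ congrArg (fun w : n ↦ (w : L)) (hz ⟨y, hy⟩)⟩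

/-- `H` normalizes `n` and, inductively, each term of the series, so each term is a sum of root
spaces and can be determined root by root. -/
lemma upperCentral_nilradical [(rootSystem H).IsIrreducible] (hbq : borel b ≤ q.toSubmodule)
    {ψ : H.root} (hψ : IsHighestRoot b ψ) (i : ℕ)
    (hi : (i : ℤ) ≤ outerHeight b (leviSimple b q) ψ) :
    upperCentral (nilradical q) i =
      rootSum {φ | outerHeight b (leviSimple b q) ψ - i < outerHeight b (leviSimple b q) φ} := by
  have hn := nilradical_eq hbq
  induction i with
  | zero =>
    rw [upperCentral_zero, eq_comm, Submodule.eq_bot_iff]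
    intro x hx
    have he : {φ | outerHeight b (leviSimple b q) ψ - (0 : ℕ) <
        outerHeight b (leviSimple b q) φ} = ∅ := by
      ext φ
      have := hψ.outerHeight_le (S := leviSimple b q) φ
      simp only [Set.mem_ofPred_eq, Set.mem_empty_iff_false, iff_false]
      lia
    rwa [he, rootSum_empty, Submodule.mem_bot] at hx
  | succ i ih =>
    push_cast at hi
    have ih := ih (by lia)
    have hUn : upperCentral (nilradical q) (i + 1) ≤ (nilradical q).toSubmodule := ambient_le _
    have hst : ∀ h ∈ H, ∀ x ∈ upperCentral (nilradical q) (i + 1),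
        ⁅h, x⁆ ∈ upperCentral (nilradical q) (i + 1) := by
      intro h hh x hx
      rw [mem_upperCentral_succ] at hx ⊢
      have hstn : ∀ y ∈ nilradical q, ⁅h, y⁆ ∈ nilradical q := by
        intro y hy
        change _ ∈ (nilradical q).toSubmodule
        rw [hn]
        exact lie_mem_rootSum_of_mem_cartan hh (hn ▸ hy)
      refine ⟨hstn x hx.1, fun y hy ↦ ?_⟩
      have h1 : ⁅y, ⁅h, x⁆⁆ = ⁅h, ⁅y, x⁆⁆ - ⁅⁅h, y⁆, x⁆ := by
        rw [lie_lie h y x]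
        abel
      rw [h1]
      refine sub_mem ?_ (hx.2 _ (hstn y hy))
      have h2 := hx.2 y hy
      rw [ih] at h2 ⊢
      exact lie_mem_rootSum_of_mem_cartan hh h2
    have hbot : upperCentral (nilradical q) (i + 1) ⊓ H.toSubmodule = ⊥ := by
      rw [eq_bot_iff, ← (disjoint_cartan_rootSum
        {φ | 0 < outerHeight b (leviSimple b q) φ}).eq_bot, ← hn, inf_comm]
      exact inf_le_inf_left _ hUn
    rw [eq_rootSum_of_inf_cartan hst hbot]
    congr 1
    ext φ
    simp only [Set.mem_ofPred_eq]
    push_cast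
    constructor
    · intro hφ
      have h0 : 0 < outerHeight b (leviSimple b q) φ := by
        have := hφ.trans hUn
        rw [hn] at this
        exact rootSub_le_rootSum_iff.1 this
      by_contra hlt
      -- A root of `n_{i+1}` of outer height at most that of `ψ` minus `i + 1` could be raised by
      -- one, giving a root of `n_i` too low for the induction hypothesis.
      obtain ⟨γ, hγ, η, hη⟩ := hψ.exists_add_mem h0 (by lia)
      have h1 : rootSub η ≤ upperCentral (nilradical q) i := by
        rw [add_comm] at hη
        refine rootSub_le_of_lie hη fun x hx y hy ↦ (mem_upperCentral_succ.1 (hφ hy)).2 x ?_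
        change _ ∈ (nilradical q).toSubmodule
        rw [hn]
        exact rootSub_le_rootSum (φ := γ) (by simp only [Set.mem_ofPred_eq]; lia) hx
      rw [ih, rootSub_le_rootSum_iff, Set.mem_ofPred_eq, outerHeight_add hη] at h1
      lia
    · intro hφ x hx
      rw [mem_upperCentral_succ, ih]
      refine ⟨?_, fun y hy ↦ ?_⟩
      · change _ ∈ (nilradical q).toSubmodule
        rw [hn]
        exact rootSub_le_rootSum (φ := φ) (by simp only [Set.mem_ofPred_eq]; lia) hx
      · have hy' : y ∈ rootSum {φ | 0 < outerHeight b (leviSimple b q) φ} := hn ▸ hy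
        refine lie_mem_rootSum ?_ ?_ hy' (rootSub_le_rootSum (Set.mem_singleton φ) hx)
        · rintro γ hγ _ rfl
          simp only [Set.mem_ofPred_eq] at hγ
          exact add_ne_zero_of_outerHeight (b := b) (S := leviSimple b q) (by lia)
        · rintro γ hγ _ rfl η hη
          simp only [Set.mem_ofPred_eq] at hγ ⊢
          rw [outerHeight_add hη]
          lia

lemma exists_not_leviSimple (hbq : borel b ≤ q.toSubmodule) (hq : q ≠ ⊤) :
    ∃ α, ¬ leviSimple b q α := by
  by_contra! hall
  apply hq
  rw [← LieSubalgebra.toSubmodule_inj, parabolic_eq hbq, LieSubalgebra.top_toSubmodule,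
    eq_cartan_sup_rootSum (H := H) (W := (⊤ : Submodule ℂ L)) (fun _ _ _ _ ↦ Submodule.mem_top) le_top]
  congr 2
  ext φ
  simp only [le_top, Set.mem_ofPred_eq, iff_true]
  exact (outerHeight_eq_zero_of_simpleCoeff fun α hα ↦ absurd (hall α) hα).ge

end TRoots

end LeviRoots

end

/-! ### The theorem -/

theorem theorem2p11 {L : Type*} [LieRing L] [LieAlgebra ℂ L] [FiniteDimensional ℂ L]
    [LieAlgebra.IsSimple ℂ L] (H : LieSubalgebra ℂ L) [H.IsCartanSubalgebra]
    (b : (LieAlgebra.IsKilling.rootSystem H).Base)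
    (q : LieSubalgebra ℂ L) (hbq : LeviRoots.borel b ≤ q.toSubmodule) (hq : q ≠ ⊤)
    (m : LieSubalgebra ℂ L) (hm : LeviRoots.IsLeviFactor q m) (hHm : H ≤ m)
    (ψ : H.root) (hψ : LeviRoots.IsHighestRoot b ψ) :
    (∀ i : ℕ, (i : ℤ) < LeviRoots.order b m (LeviRoots.resT hHm ψ) →
      ∀ ν : Module.Dual ℂ (LeviRoots.Cent m), LeviRoots.IsTRoot m ν →
        LeviRoots.tRootSpace m ν ≤ LeviRoots.layer b m i →
        ∃ α : b.support, ¬ LeviRoots.IsLeviSimple b m α ∧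
          LeviRoots.IsSimpleTRoot q m (LeviRoots.resT hHm α) ∧
          LeviRoots.IsTRoot m (ν + LeviRoots.resT hHm α) ∧
          LeviRoots.tRootSpace m (ν + LeviRoots.resT hHm α) ≤ LeviRoots.layer b m (i + 1) ∧
          LeviRoots.bracket (LeviRoots.tRootSpace m ν)
              (LeviRoots.tRootSpace m (LeviRoots.resT hHm α)) =
            LeviRoots.tRootSpace m (ν + LeviRoots.resT hHm α) ∧
          LeviRoots.bracket (LeviRoots.tRootSpace m ν)
              (LeviRoots.tRootSpace m (LeviRoots.resT hHm α)) ≠ ⊥) ∧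
    LeviRoots.tRootSpace m (LeviRoots.resT hHm ψ) =
      LeviRoots.ambient (LeviRoots.nilradical q)
        (LieAlgebra.center ℂ (LeviRoots.nilradical q)) ∧
    (∀ i : ℕ, 1 ≤ i → (i : ℤ) ≤ LeviRoots.order b m (LeviRoots.resT hHm ψ) →
      LeviRoots.upperCentral (LeviRoots.nilradical q) i =
        ⨆ j ∈ Finset.Icc 1 i,
          LeviRoots.layer b m (LeviRoots.order b m (LeviRoots.resT hHm ψ) - (j : ℤ) + 1)) ∧
    ∃ d : ℕ, (d : ℤ) = LeviRoots.order b m (LeviRoots.resT hHm ψ) ∧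
      LeviRoots.HasUpperCentralLength (LeviRoots.nilradical q) d := by
  set k := LeviRoots.outerHeight b (LeviRoots.leviSimple b q) ψ with hk
  rw [hm.order_resT hbq hHm ψ, ← hk]
  obtain ⟨α₀, hα₀⟩ := LeviRoots.exists_not_leviSimple hbq hq
  have hkpos : 1 ≤ k := by
    rw [hk, ← LeviRoots.outerHeight_simple_of_notMem hα₀]
    exact hψ.outerHeight_le _
  have hψ0 : LeviRoots.outerHeight b (LeviRoots.leviSimple b q) ψ ≠ 0 := by lia
  have hlayer : ∀ i : ℕ, (i : ℤ) ≤ k →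
      ⨆ j ∈ Finset.Icc 1 i, LeviRoots.layer b m (k - (j : ℤ) + 1) =
        LeviRoots.rootSum
          {φ | k - i < LeviRoots.outerHeight b (LeviRoots.leviSimple b q) φ} := by
    intro i hi
    apply le_antisymm
    · refine iSup₂_le fun j hj ↦ (hm.layer_le hbq hHm _).trans ?_
      refine LeviRoots.rootSum_mono fun φ hφ ↦ ?_
      rw [Finset.mem_Icc] at hj
      simp only [Set.mem_ofPred_eq] at hφ ⊢
      lia
    · refine LeviRoots.rootSum_le_iff.2 fun φ hφ ↦ ?_
      simp only [Set.mem_ofPred_eq] at hφ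
      have hle := hψ.outerHeight_le (S := LeviRoots.leviSimple b q) φ
      -- This `j` solves `k - j + 1 = outerHeight φ`.
      obtain ⟨j, hj⟩ := Int.eq_ofNat_of_zero_le
        (a := k - LeviRoots.outerHeight b (LeviRoots.leviSimple b q) φ + 1) (by lia)
      refine le_iSup₂_of_le j (Finset.mem_Icc.2 ⟨by lia, by lia⟩) ?_
      rw [hm.layer_eq hbq hHm (by lia)]
      refine LeviRoots.rootSub_le_rootSum (φ := φ) ?_
      simp only [Set.mem_ofPred_eq]
      lia
  refine ⟨?_, ?_, ?_, k.toNat, by lia, ?_, ?_⟩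
  · intro i hi ν hν hle
    obtain ⟨φ, hφ0, rfl⟩ := (hm.isTRoot_iff hbq hHm).1 hν
    have hφi : LeviRoots.outerHeight b (LeviRoots.leviSimple b q) φ = i :=
      LeviRoots.rootSub_le_rootSum_iff.1
        ((((LeviRoots.rootSub_le_tRootSpace_iff hHm).2 rfl).trans hle).trans
          (hm.layer_le hbq hHm _))
    -- The case `i = 0` does not occur: `hφ0` and `hφi` force `i` to be positive.
    obtain ⟨γ, hγ, η, hη⟩ := hψ.exists_add_mem (S := LeviRoots.leviSimple b q) (φ := φ)
      (by lia) (by lia)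
    obtain ⟨α, hα, hαγ⟩ := LeviRoots.exists_simple_sameOuter hγ
    have hres : LeviRoots.resT hHm α = LeviRoots.resT hHm γ :=
      ((hm.resT_eq_iff hbq hHm).2 hαγ).symm
    have hsum : LeviRoots.resT hHm φ + LeviRoots.resT hHm α = LeviRoots.resT hHm η := by
      rw [hres, LeviRoots.resT_add hHm hη]
    have hoη := LeviRoots.outerHeight_add (b := b) (S := LeviRoots.leviSimple b q) hη
    have hη0 : LeviRoots.outerHeight b (LeviRoots.leviSimple b q) η ≠ 0 := by lia
    have hbr := hm.bracket_eq hbq hHm hη hφ0 (by lia) hη0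
    have hηT := hm.isTRoot_resT hbq hHm hη0
    refine ⟨α, ?_, ?_, ?_, ?_, ?_, ?_⟩
    · rwa [hm.isLeviSimple_iff hbq hHm]
    · rw [hres]
      refine ⟨(hm.isPosTRoot_iff hbq hHm).2 ⟨γ, by lia, rfl⟩, fun ν₁ ν₂ h₁ h₂ h ↦ ?_⟩
      obtain ⟨φ₁, hφ₁, rfl⟩ := (hm.isPosTRoot_iff hbq hHm).1 h₁
      obtain ⟨φ₂, hφ₂, rfl⟩ := (hm.isPosTRoot_iff hbq hHm).1 h₂
      -- A sum of two positive `𝔱`-roots has order at least `2`, whereas `γ` has outer height `1`.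
      have := hm.outerHeight_eq_add_of_resT hbq hHm h
      lia
    · rwa [hsum]
    · rw [hsum]
      have := hm.tRootSpace_le_layer hbq hHm hη0
      rwa [hoη, hφi, hγ] at this
    · rw [hsum, hres, hbr]
    · rw [hres, hbr]
      exact hηT.2
  · have h1 := LeviRoots.upperCentral_nilradical hbq hψ 1 (by push_cast; lia)
    rw [← LeviRoots.upperCentral_one, h1, hm.tRootSpace_resT hbq hHm hψ0]
    congr 1
    ext φ
    simp only [Set.mem_ofPred_eq]
    constructor
    · intro h
      have := h.outerHeight_eq
      push_cast
      lia
    · intro h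
      have := hψ.outerHeight_le (S := LeviRoots.leviSimple b q) φ
      push_cast at h
      exact hψ.sameOuter (by lia)
  · intro i _ hi
    rw [LeviRoots.upperCentral_nilradical hbq hψ i hi, hlayer i hi]
  · rw [LeviRoots.upperCentral_nilradical hbq hψ _ (by lia), LeviRoots.nilradical_eq hbq]
    congr 1
    ext φ
    simp only [Set.mem_ofPred_eq]
    lia
  · intro i hi j hj hij
    rw [Set.mem_Iic] at hi hj
    rw [LeviRoots.upperCentral_nilradical hbq hψ i (by lia),
      LeviRoots.upperCentral_nilradical hbq hψ j (by lia)]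
    refine lt_of_le_of_ne (LeviRoots.rootSum_mono fun φ hφ ↦ ?_) fun h ↦ ?_
    · simp only [Set.mem_ofPred_eq] at hφ ⊢
      lia
    -- A root of outer height `k - i` belongs to `n_j` because `i < j`, but just misses `n_i`.
    · obtain ⟨φ, hφ⟩ := hψ.exists_outerHeight_eq (S := LeviRoots.leviSimple b q) hα₀
        (k := (k - i).toNat) (by lia) (by lia)
      have h1 : φ ∈ {φ | k - j < LeviRoots.outerHeight b (LeviRoots.leviSimple b q) φ} := by
        simp only [Set.mem_ofPred_eq]
        lia
      have h2 := LeviRoots.rootSub_le_rootSum h1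
      rw [hk, ← h, LeviRoots.rootSub_le_rootSum_iff, Set.mem_ofPred_eq] at h2
      lia
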